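/- **Setting.** Let $0<\mu_2<\mu_1<1$. In the two-armed Bernoulli bandit, at each time $t=1,2,\dots$ a policy picks an arm $A_t\in\{1,2\}$ from the past observations $(A_1,R_1,\dots,A_{t-1},R_{t-1})$, possibly with extra randomness, and then observes a reward $R_t\in\{0,1\}$, which given the past and $A_t$ has law $\mathrm B(\mu_{A_t})$. Let $N_a(t)=\#\{1\le i<t: A_i=a\}$ and let $\hat\mu_a(t)$ be the empirical mean of the rewards of arm $a$ before time $t$; $-a$ denotes the other arm. An *index* is a function $I(x,y,n,t)\in[0,I_{\max}]$, $I_{\max}\in(0,\infty]$, of $x,y\in[0,1]$ and real $n\ge1$, $t\ge1$. The *index policy* of $I$ plays, at every time $t$, an arm that maximizes $I_a(t)=I(\hat\mu_a(t),\hat\mu_{-a}(t),N_a(t),t)$, with $I_a(t)=+\infty$ if $N_a(t)=0$; ties are broken arbitrarily. **Conventions.** For real sequences, $u\sim v$ means $u-v=o(v)$ as $t\to\infty$. A property holds *in the neighborhood of* a sequence $p$ of vectors if it holds for all sequences $q$ with $q\sim p$ coordinatewise (with values in the domain of $I$). The symbols $\partial_{\mu_a}I_a,\ \partial_{\mu_{-a}}I_a,\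 \partial_nI_a,\ \partial_tI_a$ are the partial derivatives of $I$ in its first, second, third and fourth argument, at the point where $I_a$ is evaluated. **Assumptions on $I$.** - (A1) $I$ is nondecreasing in $x$, nonincreasing in $y$, nonincreasing in $n$ and nondecreasing in $t$. - (A2) For every integer $n\ge1$ and $\nu_2\in[0,1]$, in the neighborhood of $(\nu_2,\mu_1,n)$, $I(x(t),y(t),m(t),t)\to I_{\max}$. - (A3) In the neighborhood of $(\mu_1,\mu_2,t)$, $I(x(t),y(t),m(t),t)$ converges to a constant $I(\mu_1,\mu_2)$ with $0<I(\mu_1,\mu_2)<I_{\max}$. Moreover, for every $\nu\in[0,1]$ there is $c<I_{\max}$ such that, in the neighborhood of $(\mu_1,\nu,t)$, eventually $I(x(t),y(t),m(t),t)\le c$. - (A4) There is $\varepsilon>0$ such that for all large real $t$ and all $\nu_1,\nu_2,x$ within relative distance less than $\varepsilon$ of $\mu_1,\mu_2,I(\mu_1,\mu_2)$, there is exactly one $n\ge1$ with $I(\nu_2,\nu_1,n,t)=x$, denoted $f_{\nu_1,\nu_2,x}(t)$; and on the sequences $(\nu_1(t),\nu_2(t),x(t))$ that eventually lie in this range, equivalent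 arguments give equivalent sequences $f_{\nu_1(t),\nu_2(t),x(t)}(t)$. Put $n_2(t)=f_{\mu_1,\mu_2,I(\mu_1,\mu_2)}(t)$. - (A5) There is $\ell$ with $\ell(0)=0$ and $\ell(\varepsilon)>0$ for $\varepsilon>0$ such that, in the neighborhood of $(\mu_1,\mu_2)$, eventually $I(\nu_2(t),\nu_1(t),(1+\varepsilon)n_2(t),t)\le(1-\ell(\varepsilon))\,I(\nu_2(t),\nu_1(t),n_2(t),t)$ for each $\varepsilon>0$, and eventually $I(\nu_2(t),\nu_1(t),(1-\varepsilon)n_2(t),t)\ge(1+\ell(\varepsilon))\,I(\nu_2(t),\nu_1(t),n_2(t),t)$ for each $\varepsilon\in(0,1)$. - (A6) $n_2(t)=o(t)$, $n_2(t)\to\infty$, and $n_2(t)\sim n_2(at)$ for every $a>0$. In (A7)–(A9), $(\nu_1,\nu_2,m_1,m_2)$ ranges over the neighborhood of the asymptotic regime $(\mu_1,\mu_2,t,n_2(t))$, and $I_a(t)=I(\nu_a(t),\nu_{-a}(t),m_a(t),t)$. - (A7) For both arms, eventually $I_a(t)$ is finite and its partial derivatives exist, and for each fixed integer $h\ge1$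 the difference $I_a(t+h)-I_a(t)$ equals $$(\nu_a(t+h)-\nu_a(t))\,\partial_{\mu_a}I_a(t)+(\nu_{-a}(t+h)-\nu_{-a}(t))\,\partial_{\mu_{-a}}I_a(t)+(m_a(t+h)-m_a(t))\,\partial_nI_a(t)+h\,\partial_tI_a(t)$$ up to an error that is $o$ of the sum of the absolute values of these four terms. - (A8) For a constant $\rho\in[0,1)$, $\partial_nI_2(t)\sim-\frac{\rho(1-\mu_2)}{m_2(t)}\,\partial_{\mu_2}I_2(t)$. - (A9) $\partial_tI_1(t)=o(\partial_nI_2(t))$, $\partial_tI_2(t)=o(\partial_nI_2(t))$ and $\partial_{\mu_2}I_1(t)=o(\partial_{\mu_2}I_2(t))$. **Theorem.** Let $I$ be an index satisfying (A1)–(A9), run its index policy, and let $T\in\mathbb N$. (1) Almost surely, the sliding regret satisfies $$\limsup_{t\to\infty}\Bigl(T\mu_1-\sum_{i=1}^T\mu_{A_{t+i}}\Bigr)=(\mu_1-\mu_2)\,T.$$ (2) Let $\tau_1=\inf\{t\ge1:A_t=2\}$ and $\tau_{k+1}=\inf\{t>\tau_k:A_t=2,\ A_{t-1}=1\}$ be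 the exploration episodes. Almost surely they are all finite. Let $(X_t)_{t\ge1}$ be i.i.d. with law $\mathrm B(\mu_2)$ and $$\sigma_T=T\wedge\inf\Bigl\{t\ge1:\ -\rho(1-\mu_2)+\tfrac1t\sum_{i=1}^t(X_i-\mu_2)\le0\Bigr\}.$$ Then the regret of exploration satisfies $$\limsup_{k\to\infty}\mathbb E\Bigl[\sum_{i=0}^{T-1}(\mu_1-\mu_{A_{\tau_k+i}})\Bigr]\ \ge\ (\mu_1-\mu_2)\,\mathbb E[\sigma_T].$$ -/

import Mathlib

open Filter Asymptotics MeasureTheory ProbabilityTheory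
open scoped Topology ENNReal

/-! ## Two-armed Bernoulli bandits

The arms are `0 : Fin 2` (the optimal arm, "arm 1") and `1 : Fin 2` (the suboptimal arm, "arm 2");
the other arm of `a` is `1 - a`.  Times are `t = 1, 2, 3, …`; the values of the processes at time
`0` are irrelevant. -/

/-- The mean of each arm. -/
def armMean (μ₁ μ₂ : ℝ) (a : Fin 2) : ℝ := ![μ₁, μ₂] a

/-- Arms `A t` and rewards `R t` (`true` is a success) produced by some, possibly randomized, policy
playing the Bernoulli bandit: given the past and the arm chosen at time `t`, the reward is a
Bernoulli variable whose parameter is the mean of the chosen arm. -/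
structure IsBanditRun {Ω : Type*} [MeasurableSpace Ω] (P : Measure Ω) (μ₁ μ₂ : ℝ)
    (A : ℕ → Ω → Fin 2) (R : ℕ → Ω → Bool) : Prop where
  measurable_arm : ∀ t, Measurable (A t)
  measurable_reward : ∀ t, Measurable (R t)
  reward_law : ∀ t, 1 ≤ t → ∀ (a : ℕ → Fin 2) (r : ℕ → Bool),
    P {ω | (∀ i ∈ Finset.Ico 1 t, A i ω = a i ∧ R i ω = r i) ∧ A t ω = a t ∧ R t ω = true} =
      ENNReal.ofReal (armMean μ₁ μ₂ (a t)) *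
        P {ω | (∀ i ∈ Finset.Ico 1 t, A i ω = a i ∧ R i ω = r i) ∧ A t ω = a t}

/-- `N_a(t)`: number of visits of arm `a` strictly before time `t`, along one trajectory. -/
def visits (α : ℕ → Fin 2) (a : Fin 2) (t : ℕ) : ℕ :=
  ((Finset.Ico 1 t).filter fun i => α i = a).card

/-- Number of successes of arm `a` strictly before time `t`, along one trajectory. -/
def successes (α : ℕ → Fin 2) (r : ℕ → Bool) (a : Fin 2) (t : ℕ) : ℕ :=
  ((Finset.Ico 1 t).filter fun i => α i = a ∧ r i = true).card

/-- Empirical mean of arm `a` at time `t` (`0` for an unvisited arm). -/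
noncomputable def empMean (α : ℕ → Fin 2) (r : ℕ → Bool) (a : Fin 2) (t : ℕ) : ℝ :=
  (successes α r a t : ℝ) / (visits α a t : ℝ)

/-! ## Index policies

An index is a function `I x y n t` of the empirical mean `x` of the considered arm, the empirical
mean `y` of the other arm, the number `n` of visits of the considered arm, and the time `t`.  It
matters for `x, y ∈ [0, 1]`, real `n ≥ 1` and real `t ≥ 1`. -/

/-- The index of arm `a` at time `t` along a trajectory; it is `+∞` for an unvisited arm. -/
noncomputable def armIndex (I : ℝ → ℝ → ℝ → ℝ → ℝ≥0∞) (α : ℕ → Fin 2) (r : ℕ → Bool)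
    (a : Fin 2) (t : ℕ) : ℝ≥0∞ :=
  if visits α a t = 0 then ⊤
  else I (empMean α r a t) (empMean α r (1 - a) t) (visits α a t) t

/-- Almost surely, at every time the arm that is played has maximal index (arbitrary ties). -/
def FollowsIndex {Ω : Type*} [MeasurableSpace Ω] (P : Measure Ω)
    (I : ℝ → ℝ → ℝ → ℝ → ℝ≥0∞) (A : ℕ → Ω → Fin 2) (R : ℕ → Ω → Bool) : Prop :=
  ∀ᵐ ω ∂P, ∀ t, 1 ≤ t → ∀ b : Fin 2,
    armIndex I (fun s => A s ω) (fun s => R s ω) b t ≤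
      armIndex I (fun s => A s ω) (fun s => R s ω) (A t ω) t

/-- The partial inverse of the index of arm 2 in the number of visits: the number of visits `n ≥ 1`
for which that index equals `x` at time `t`, when the empirical means of the two arms are `ν₁`
and `ν₂`. -/
noncomputable def inverseVisits (I : ℝ → ℝ → ℝ → ℝ → ℝ≥0∞) (ν₁ ν₂ x t : ℝ) : ℝ :=
  Function.invFunOn (fun n : ℝ => I ν₂ ν₁ n t) (Set.Ici 1) (ENNReal.ofReal x)

/-- Partial derivative in the empirical mean of the considered arm. -/
noncomputable def dOwn (I : ℝ → ℝ → ℝ → ℝ → ℝ≥0∞) (x y n t : ℝ) : ℝ :=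
  deriv (fun z => (I z y n t).toReal) x

/-- Partial derivative in the empirical mean of the other arm. -/
noncomputable def dOther (I : ℝ → ℝ → ℝ → ℝ → ℝ≥0∞) (x y n t : ℝ) : ℝ :=
  deriv (fun z => (I x z n t).toReal) y

/-- Partial derivative in the number of visits. -/
noncomputable def dVisits (I : ℝ → ℝ → ℝ → ℝ → ℝ≥0∞) (x y n t : ℝ) : ℝ :=
  deriv (fun z => (I x y z t).toReal) n

/-- Partial derivative in time. -/
noncomputable def dTime (I : ℝ → ℝ → ℝ → ℝ → ℝ≥0∞) (x y n t : ℝ) : ℝ :=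
  deriv (fun z => (I x y n z).toReal) t

/-- The index is finite and its four partial derivatives exist at a point. -/
def HasPartials (I : ℝ → ℝ → ℝ → ℝ → ℝ≥0∞) (x y n t : ℝ) : Prop :=
  I x y n t ≠ ⊤ ∧
  DifferentiableAt ℝ (fun z => (I z y n t).toReal) x ∧
  DifferentiableAt ℝ (fun z => (I x z n t).toReal) y ∧
  DifferentiableAt ℝ (fun z => (I x y z t).toReal) n ∧
  DifferentiableAt ℝ (fun z => (I x y n z).toReal) t

/-- The sequences of empirical means `ν a` and numbers of visits `m a` are coordinatewise equivalent
to the asymptotic regime `t ↦ (μ₁, μ₂, t, n₂ t)`. -/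
structure InRegime (μ₁ μ₂ : ℝ) (n₂ : ℝ → ℝ) (ν m : Fin 2 → ℕ → ℝ) : Prop where
  mean_one : ν 0 ~[atTop] fun _ => μ₁
  mean_two : ν 1 ~[atTop] fun _ => μ₂
  visits_one : m 0 ~[atTop] fun t => (t : ℝ)
  visits_two : m 1 ~[atTop] fun t => n₂ (t : ℝ)

/-- The regularity assumptions on an index with values in `[0, Imax]`, for the bandit `(μ₁, μ₂)`.
Here `L` is the limit of the index of the optimal arm and `ρ` the optimism constant.  A property
"in the neighborhood of" a sequence `p` in the topology of coordinatewise equivalence is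
expressed by quantifying over all the sequences that are equivalent to `p`. -/
structure IsRegularIndex (I : ℝ → ℝ → ℝ → ℝ → ℝ≥0∞) (Imax : ℝ≥0∞) (μ₁ μ₂ L ρ : ℝ) : Prop where
  le_max : ∀ x ∈ Set.Icc (0 : ℝ) 1, ∀ y ∈ Set.Icc (0 : ℝ) 1, ∀ n t : ℝ, 1 ≤ n → 1 ≤ t →
    I x y n t ≤ Imax
  -- monotonicity
  mono : ∀ x ∈ Set.Icc (0 : ℝ) 1, ∀ x' ∈ Set.Icc (0 : ℝ) 1, ∀ y ∈ Set.Icc (0 : ℝ) 1,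
    ∀ y' ∈ Set.Icc (0 : ℝ) 1, ∀ n n' t t' : ℝ, 1 ≤ n → 1 ≤ n' → 1 ≤ t → 1 ≤ t' →
    x ≤ x' → y' ≤ y → n' ≤ n → t ≤ t' → I x y n t ≤ I x' y' n' t'
  -- divergence in `t`
  diverges : ∀ n : ℕ, 1 ≤ n → ∀ ν₂ ∈ Set.Icc (0 : ℝ) 1, ∀ x y m : ℕ → ℝ,
    (∀ t, x t ∈ Set.Icc (0 : ℝ) 1) → (∀ t, y t ∈ Set.Icc (0 : ℝ) 1) → (∀ t, 1 ≤ m t) →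
    (x ~[atTop] fun _ => ν₂) → (y ~[atTop] fun _ => μ₁) → (m ~[atTop] fun _ => (n : ℝ)) →
    Tendsto (fun t : ℕ => I (x t) (y t) (m t) t) atTop (𝓝 Imax)
  -- convergence
  limit_pos : 0 < L
  limit_lt_max : ENNReal.ofReal L < Imax
  converges : ∀ x y m : ℕ → ℝ,
    (∀ t, x t ∈ Set.Icc (0 : ℝ) 1) → (∀ t, y t ∈ Set.Icc (0 : ℝ) 1) → (∀ t, 1 ≤ m t) →
    (x ~[atTop] fun _ => μ₁) → (y ~[atTop] fun _ => μ₂) → (m ~[atTop] fun t => (t : ℝ)) →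
    Tendsto (fun t : ℕ => I (x t) (y t) (m t) t) atTop (𝓝 (ENNReal.ofReal L))
  -- the index of an arm that is played linearly often stays away from the maximal value
  bounded_away : ∀ ν ∈ Set.Icc (0 : ℝ) 1, ∃ c < Imax, ∀ x y m : ℕ → ℝ,
    (∀ t, x t ∈ Set.Icc (0 : ℝ) 1) → (∀ t, y t ∈ Set.Icc (0 : ℝ) 1) → (∀ t, 1 ≤ m t) →
    (x ~[atTop] fun _ => μ₁) → (y ~[atTop] fun _ => ν) → (m ~[atTop] fun t => (t : ℝ)) →
    ∀ᶠ t : ℕ in atTop, I (x t) (y t) (m t) t ≤ c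
  -- continuous inverse in the number of visits
  inverse : ∃ ε > 0,
    (∀ᶠ t : ℝ in atTop, ∀ ν₁ ν₂ x : ℝ,
      |ν₁ - μ₁| < ε * μ₁ → |ν₂ - μ₂| < ε * μ₂ → |x - L| < ε * L →
      ∃! n : ℝ, 1 ≤ n ∧ I ν₂ ν₁ n t = ENNReal.ofReal x) ∧
    ∀ ν₁ ν₂ x ν₁' ν₂' x' : ℕ → ℝ,
      (∀ᶠ t in atTop, |ν₁ t - μ₁| < ε * μ₁ ∧ |ν₂ t - μ₂| < ε * μ₂ ∧ |x t - L| < ε * L) →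
      (∀ᶠ t in atTop, |ν₁' t - μ₁| < ε * μ₁ ∧ |ν₂' t - μ₂| < ε * μ₂ ∧ |x' t - L| < ε * L) →
      (ν₁' ~[atTop] ν₁) → (ν₂' ~[atTop] ν₂) → (x' ~[atTop] x) →
      (fun t : ℕ => inverseVisits I (ν₁' t) (ν₂' t) (x' t) t) ~[atTop]
        fun t : ℕ => inverseVisits I (ν₁ t) (ν₂ t) (x t) t
  -- asymptotic monotonicity in the number of visits
  asymp_mono : ∃ ℓ : ℝ → ℝ, ℓ 0 = 0 ∧ (∀ ε > 0, 0 < ℓ ε) ∧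
    ∀ ν₁ ν₂ : ℕ → ℝ, (ν₁ ~[atTop] fun _ => μ₁) → (ν₂ ~[atTop] fun _ => μ₂) →
      (∀ ε > 0, ∀ᶠ t : ℕ in atTop,
        I (ν₂ t) (ν₁ t) ((1 + ε) * inverseVisits I μ₁ μ₂ L t) t ≤
          ENNReal.ofReal (1 - ℓ ε) * I (ν₂ t) (ν₁ t) (inverseVisits I μ₁ μ₂ L t) t) ∧
      (∀ ε > 0, ε < 1 → ∀ᶠ t : ℕ in atTop,
        ENNReal.ofReal (1 + ℓ ε) * I (ν₂ t) (ν₁ t) (inverseVisits I μ₁ μ₂ L t) t ≤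
          I (ν₂ t) (ν₁ t) ((1 - ε) * inverseVisits I μ₁ μ₂ L t) t)
  -- no regret
  sublinear : (fun t : ℝ => inverseVisits I μ₁ μ₂ L t) =o[atTop] fun t : ℝ => t
  tendsto_visits : Tendsto (fun t : ℝ => inverseVisits I μ₁ μ₂ L t) atTop atTop
  slow_visits : ∀ a : ℝ, 0 < a →
    (fun t : ℝ => inverseVisits I μ₁ μ₂ L t) ~[atTop] fun t : ℝ => inverseVisits I μ₁ μ₂ L (a * t)
  -- Taylor expansion; the error is negligible with respect to the sizes of the terms
  hasPartials : ∀ ν m, InRegime μ₁ μ₂ (inverseVisits I μ₁ μ₂ L) ν m → ∀ a : Fin 2,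
    ∀ᶠ t : ℕ in atTop, HasPartials I (ν a t) (ν (1 - a) t) (m a t) t
  taylor : ∀ ν m, InRegime μ₁ μ₂ (inverseVisits I μ₁ μ₂ L) ν m → ∀ a : Fin 2,
    ∀ h : ℕ, 1 ≤ h →
    (fun t : ℕ =>
      ((I (ν a (t + h)) (ν (1 - a) (t + h)) (m a (t + h)) ((t + h : ℕ) : ℝ)).toReal
          - (I (ν a t) (ν (1 - a) t) (m a t) t).toReal)
        - ((ν a (t + h) - ν a t) * dOwn I (ν a t) (ν (1 - a) t) (m a t) t
          + (ν (1 - a) (t + h) - ν (1 - a) t) * dOther I (ν a t) (ν (1 - a) t) (m a t) t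
          + (m a (t + h) - m a t) * dVisits I (ν a t) (ν (1 - a) t) (m a t) t
          + h * dTime I (ν a t) (ν (1 - a) t) (m a t) t))
      =o[atTop]
    (fun t : ℕ =>
      |(ν a (t + h) - ν a t) * dOwn I (ν a t) (ν (1 - a) t) (m a t) t|
        + |(ν (1 - a) (t + h) - ν (1 - a) t) * dOther I (ν a t) (ν (1 - a) t) (m a t) t|
        + |(m a (t + h) - m a t) * dVisits I (ν a t) (ν (1 - a) t) (m a t) t|
        + |h * dTime I (ν a t) (ν (1 - a) t) (m a t) t|)
  -- `ρ`-optimism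
  rho_nonneg : 0 ≤ ρ
  rho_lt_one : ρ < 1
  optimism : ∀ ν m, InRegime μ₁ μ₂ (inverseVisits I μ₁ μ₂ L) ν m →
    (fun t : ℕ => dVisits I (ν 1 t) (ν 0 t) (m 1 t) t) ~[atTop]
      fun t : ℕ => -(ρ * (1 - μ₂) / m 1 t) * dOwn I (ν 1 t) (ν 0 t) (m 1 t) t
  -- negligible derivatives
  negligible_time_one : ∀ ν m, InRegime μ₁ μ₂ (inverseVisits I μ₁ μ₂ L) ν m →
    (fun t : ℕ => dTime I (ν 0 t) (ν 1 t) (m 0 t) t) =o[atTop]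
      fun t : ℕ => dVisits I (ν 1 t) (ν 0 t) (m 1 t) t
  negligible_time_two : ∀ ν m, InRegime μ₁ μ₂ (inverseVisits I μ₁ μ₂ L) ν m →
    (fun t : ℕ => dTime I (ν 1 t) (ν 0 t) (m 1 t) t) =o[atTop]
      fun t : ℕ => dVisits I (ν 1 t) (ν 0 t) (m 1 t) t
  negligible_mean : ∀ ν m, InRegime μ₁ μ₂ (inverseVisits I μ₁ μ₂ L) ν m →
    (fun t : ℕ => dOther I (ν 0 t) (ν 1 t) (m 0 t) t) =o[atTop]
      fun t : ℕ => dOwn I (ν 1 t) (ν 0 t) (m 1 t) t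

/-! ## Regrets -/

/-- Sliding regret of a trajectory (`μ₁` is the optimal mean). -/
noncomputable def slidingRegret (μ₁ μ₂ : ℝ) (α : ℕ → Fin 2) (T : ℕ) : ℝ :=
  limsup (fun t : ℕ => (T : ℝ) * μ₁ - ∑ i ∈ Finset.Icc 1 T, armMean μ₁ μ₂ (α (t + i))) atTop

/-- Exploration episodes of a trajectory, numbered from `0`: the first time arm 2 is played, and then
the successive times at which arm 2 is played right after arm 1; `⊤` if there is none. -/
noncomputable def explorationTime (α : ℕ → Fin 2) : ℕ → ℕ∞
  | 0 => sInf {τ : ℕ∞ | ∃ t : ℕ, τ = (t : ℕ∞) ∧ 1 ≤ t ∧ α t = 1}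
  | k + 1 => sInf {τ : ℕ∞ | ∃ t : ℕ, τ = (t : ℕ∞) ∧ explorationTime α k < (t : ℕ∞) ∧
      α t = 1 ∧ α (t - 1) = 0}

/-- Pseudo-regret of a trajectory over the `T` plays at times `s, s + 1, …, s + T - 1`. -/
noncomputable def windowRegret (μ₁ μ₂ : ℝ) (α : ℕ → Fin 2) (s T : ℕ) : ℝ :=
  ∑ i ∈ Finset.range T, (μ₁ - armMean μ₁ μ₂ (α (s + i)))

/-- Regret of exploration (meaningful when all the exploration episodes are almost surely finite). -/
noncomputable def regretOfExploration {Ω : Type*} [MeasurableSpace Ω] (P : Measure Ω)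
    (μ₁ μ₂ : ℝ) (A : ℕ → Ω → Fin 2) (T : ℕ) : ℝ :=
  limsup (fun k : ℕ => ∫ ω, windowRegret μ₁ μ₂ (fun t => A t ω)
    (explorationTime (fun t => A t ω) k).toNat T ∂P) atTop

/-- `σ_T`, the minimum of `T` and of the first `t ≥ 1` with
`-ρ (1 - μ₂) + (1 / t) ∑_{i = 1}^t (x_i - μ₂) ≤ 0`. -/
noncomputable def clippedHittingTime (μ₂ ρ : ℝ) (x : ℕ → ℝ) (T : ℕ) : ℕ :=
  (min (T : ℕ∞) (sInf {τ : ℕ∞ | ∃ t : ℕ, τ = (t : ℕ∞) ∧ 1 ≤ t ∧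
    -(ρ * (1 - μ₂)) + (1 / (t : ℝ)) * ∑ i ∈ Finset.Icc 1 t, (x i - μ₂) ≤ 0})).toNat

/-! The proof separates probability from the analysis of a single trajectory.

Probability: select plays of one arm by a rule that looks only at the arms played so far, the
current one included. The rewards at the selected times are then dominated by an i.i.d. Bernoulli
sequence, and have exactly that law if almost surely infinitely many times are selected. Selecting
all plays of an arm gives the law of large numbers and arbitrarily long runs of successes. Selecting
the plays of arm 2 from the `k`-th exploration on gives a reward sequence whose law does not depend
on `k`.

Analysis, on a trajectory where the law of large numbers holds: divergence of a neglected arm's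
index forces both arms to be played infinitely often. Comparing the index of arm 2 with the limit
`L` of the other index then pins its number of visits to `n₂ t`, so the trajectory lies in the
asymptotic regime and the Taylor expansion applies. Suppose arm 2 is played from `t` to `t + h - 1`
with `N` earlier visits and average reward `K / h`. With `D` the derivative of its index in its own
mean, to first order this index moves by `h (D / N) (K / h - μ₂ - ρ (1 - μ₂))`, the second negative
term coming from optimism, while the index of arm 1 moves negligibly in comparison. Since arm 2 had
the larger index at `t`, it is played again at `t + h` as soon as the bracket is positive
(`IsTypical.eventually_play`).

Both claims follow. A run of successes has average `1` and bracket `(1 - ρ)(1 - μ₂) > 0`, so arm 2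
fills windows of length `T` infinitely often. For all large `k`, the `k`-th exploration lasts at
least the clipped hitting time of its own rewards. These rewards are i.i.d., and dominated
convergence turns the pathwise bound into a bound on expectations. -/

/-! ## Rewards collected at predictable times -/

section Rewards

variable {Ω : Type*} {A : ℕ → Ω → Fin 2} {R : ℕ → Ω → Bool}

/-- The arms and rewards observed before time `t`, and the arm played at time `t`. -/
def history (A : ℕ → Ω → Fin 2) (R : ℕ → Ω → Bool) (t : ℕ) (ω : Ω) :
    (Finset.Ico 1 t → Fin 2 × Bool) × Fin 2 :=
  (fun i => (A i ω, R i ω), A t ω)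

theorem history_eq_iff {t : ℕ} {ω ω' : Ω} :
    history A R t ω = history A R t ω' ↔
      (∀ i ∈ Finset.Ico 1 t, A i ω = A i ω' ∧ R i ω = R i ω') ∧ A t ω = A t ω' := by
  simp [history, funext_iff, Prod.ext_iff]

theorem preimage_image_history {t : ℕ} {B : Set Ω}
    (hB : ∀ ω ω', history A R t ω = history A R t ω' → ω ∈ B → ω' ∈ B) :
    history A R t ⁻¹' (history A R t '' B) = B := by
  refine Set.Subset.antisymm ?_ (Set.subset_preimage_image _ _)
  rintro ω ⟨ω', hω', h⟩
  exact hB ω' ω h hω'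

/-- A predictable rule selecting some of the times at which arm `a` is played. -/
structure IsSelection (a : Fin 2) (p : (ℕ → Fin 2) → ℕ → Prop) : Prop where
  one_le : ∀ α t, p α t → 1 ≤ t
  arm_eq : ∀ α t, p α t → α t = a
  congr : ∀ α α' t, (∀ i ∈ Finset.Icc 1 t, α i = α' i) → p α t → p α' t

variable {a : Fin 2} {p : (ℕ → Fin 2) → ℕ → Prop}

theorem IsSelection.iff_of_history (hp : IsSelection a p) {t : ℕ} {ω ω' : Ω}
    (h : history A R t ω = history A R t ω') {s : ℕ} (hs : s ≤ t) :
    p (fun s => A s ω) s ↔ p (fun s => A s ω') s := by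
  rw [history_eq_iff] at h
  have key : ∀ i ∈ Finset.Icc 1 s, A i ω = A i ω' := by
    intro i hi
    rw [Finset.mem_Icc] at hi
    rcases lt_or_eq_of_le (hi.2.trans hs) with h1 | rfl
    · exact (h.1 i (Finset.mem_Ico.2 ⟨hi.1, h1⟩)).1
    · exact h.2
  exact ⟨hp.congr _ _ _ key, hp.congr _ _ _ fun i hi => (key i hi).symm⟩

theorem IsSelection.count_eq_of_history [∀ α, DecidablePred (p α)]
    (hp : IsSelection a p) {t : ℕ} {ω ω' : Ω}
    (h : history A R t ω = history A R t ω') {s : ℕ} (hs : s ≤ t) :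
    Nat.count (p fun s => A s ω) s = Nat.count (p fun s => A s ω') s := by
  refine le_antisymm (Nat.count_mono_left fun k hk => ?_) (Nat.count_mono_left fun k hk => ?_)
  · exact (hp.iff_of_history h (hk.le.trans hs)).1
  · exact (hp.iff_of_history h (hk.le.trans hs)).2

/-- The rewards obtained at the successive selected times. -/
noncomputable def selectedReward (A : ℕ → Ω → Fin 2) (R : ℕ → Ω → Bool)
    (p : (ℕ → Fin 2) → ℕ → Prop) (ω : Ω) (n : ℕ) : Bool :=
  R (Nat.nth (p fun t => A t ω) n) ω

open Classical in
/-- The event that the `n`-th selected time is `t` and that the rewards at the previous ones are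
given by `y`. -/
def selectionEvent (A : ℕ → Ω → Fin 2) (R : ℕ → Ω → Bool) (p : (ℕ → Fin 2) → ℕ → Prop)
    (y : ℕ → Bool) (n t : ℕ) : Set Ω :=
  {ω | p (fun s => A s ω) t ∧ Nat.count (p fun s => A s ω) t = n ∧
    ∀ s < t, p (fun s => A s ω) s → R s ω = y (Nat.count (p fun s => A s ω) s)}

/-- Only rewards strictly before `t` enter the event, whereas the arm at time `t` is part of the
history: the event is settled just before the reward at `t` is drawn. -/
theorem selectionEvent_of_history (hp : IsSelection a p) (y : ℕ → Bool) (n t : ℕ) (ω ω' : Ω)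
    (h : history A R t ω = history A R t ω') (hω : ω ∈ selectionEvent A R p y n t) :
    ω' ∈ selectionEvent A R p y n t := by
  classical
  obtain ⟨h1, h2, h3⟩ := hω
  refine ⟨(hp.iff_of_history h le_rfl).1 h1, ?_, fun s hs hps => ?_⟩
  · rw [← h2]; exact (hp.count_eq_of_history h le_rfl).symm
  · have hps' := (hp.iff_of_history h hs.le).2 hps
    have h4 := h3 s hs hps'
    have h5 := hp.count_eq_of_history h hs.le
    rw [← h5, ← h4]
    exact (((history_eq_iff.1 h).1 s (Finset.mem_Ico.2 ⟨hp.one_le _ _ hps, hs⟩)).2).symm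

variable [MeasurableSpace Ω] {P : Measure Ω} {μ₁ μ₂ : ℝ}

theorem IsBanditRun.measurable_history (h : IsBanditRun P μ₁ μ₂ A R) (t : ℕ) :
    Measurable (history A R t) := by
  refine Measurable.prodMk (measurable_pi_lambda _ fun i => ?_) (h.measurable_arm t)
  exact (h.measurable_arm i).prodMk (h.measurable_reward i)

theorem IsBanditRun.measurableSet_of_history (h : IsBanditRun P μ₁ μ₂ A R) {t : ℕ} {B : Set Ω}
    (hB : ∀ ω ω', history A R t ω = history A R t ω' → ω ∈ B → ω' ∈ B) : MeasurableSet B := by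
  rw [← preimage_image_history hB]
  exact h.measurable_history t (Set.toFinite _).measurableSet

/-- The history takes finitely many values, so `B` is a finite disjoint union of its atoms, and
`reward_law` is the claim on each atom. -/
theorem IsBanditRun.measure_inter_success (h : IsBanditRun P μ₁ μ₂ A R) {t : ℕ} (ht : 1 ≤ t)
    {a : Fin 2} {B : Set Ω}
    (hB : ∀ ω ω', history A R t ω = history A R t ω' → ω ∈ B → ω' ∈ B)
    (hBa : ∀ ω ∈ B, A t ω = a) :
    P (B ∩ {ω | R t ω = true}) = ENNReal.ofReal (armMean μ₁ μ₂ a) * P B := by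
  classical
  have hR : MeasurableSet {ω | R t ω = true} := h.measurable_reward t (measurableSet_singleton true)
  set S : Finset ((Finset.Ico 1 t → Fin 2 × Bool) × Fin 2) :=
    (Set.toFinite (history A R t '' B)).toFinset with hS
  have hBS : history A R t ⁻¹' (S : Set _) = B := by
    rw [hS, Set.Finite.coe_toFinset, preimage_image_history hB]
  have hm : ∀ y ∈ S, MeasurableSet (history A R t ⁻¹' {y}) := fun y _ =>
    h.measurable_history t (measurableSet_singleton y)
  have h1 := sum_measure_preimage_singleton (μ := P) S hm
  have h2 := sum_measure_preimage_singleton (μ := P.restrict {ω | R t ω = true}) S hm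
  rw [hBS] at h1 h2
  rw [← Measure.restrict_apply' hR, ← h2, ← h1, Finset.mul_sum]
  refine Finset.sum_congr rfl fun y hy => ?_
  rw [hS, Set.Finite.mem_toFinset] at hy
  obtain ⟨ω, hω, rfl⟩ := hy
  have key := h.reward_law t ht (fun i => A i ω) (fun i => R i ω)
  simp only [hBa ω hω] at key
  rw [Measure.restrict_apply' hR]
  have e1 : history A R t ⁻¹' {history A R t ω} =
      {ω' | (∀ i ∈ Finset.Ico 1 t, A i ω' = A i ω ∧ R i ω' = R i ω) ∧ A t ω' = a} := by
    ext ω'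
    simp only [Set.mem_preimage, Set.mem_singleton_iff, history_eq_iff, Set.mem_ofPred_eq, hBa ω hω]
  have e2 : history A R t ⁻¹' {history A R t ω} ∩ {ω | R t ω = true} =
      {ω' | (∀ i ∈ Finset.Ico 1 t, A i ω' = A i ω ∧ R i ω' = R i ω) ∧ A t ω' = a ∧
        R t ω' = true} := by
    rw [e1]; ext ω'
    simp only [Set.mem_inter_iff, Set.mem_ofPred_eq, and_assoc]
  rw [e2, e1, key]

/-- The law of a reward of mean `p`. -/
noncomputable abbrev rewardLaw (p : unitInterval) : Measure Bool := bernoulliMeasure true false p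

theorem IsBanditRun.measure_inter_reward [IsProbabilityMeasure P] (h : IsBanditRun P μ₁ μ₂ A R)
    {t : ℕ} (ht : 1 ≤ t) {a : Fin 2} {p : unitInterval} (hp : (p : ℝ) = armMean μ₁ μ₂ a) {B : Set Ω}
    (hB : ∀ ω ω', history A R t ω = history A R t ω' → ω ∈ B → ω' ∈ B)
    (hBa : ∀ ω ∈ B, A t ω = a) (b : Bool) :
    P (B ∩ {ω | R t ω = b}) = rewardLaw p {b} * P B := by
  classical
  have hs := h.measure_inter_success ht hB hBa
  have hp1 : ENNReal.ofReal (armMean μ₁ μ₂ a) = rewardLaw p {true} := by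
    rw [bernoulliMeasure_apply p (measurableSet_singleton _), ← hp]
    simp [ENNReal.ofReal, unitInterval.toNNReal, Real.toNNReal_of_nonneg p.2.1]
    rfl
  rw [hp1] at hs
  cases b with
  | true => exact hs
  | false =>
    have hsum : rewardLaw p {true} + rewardLaw p {false} = 1 := by
      rw [← measure_union (by simp) (measurableSet_singleton _)]
      have : ({true} ∪ {false} : Set Bool) = Set.univ := by ext b; cases b <;> simp
      rw [this, measure_univ]
    have hR : MeasurableSet {ω | R t ω = true} :=
      h.measurable_reward t (measurableSet_singleton true)
    have hsplit := measure_inter_add_sdiff (μ := P) B hR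
    have e : B \ {ω | R t ω = true} = B ∩ {ω | R t ω = false} := by
      ext ω; simp
    rw [e, hs] at hsplit
    have : rewardLaw p {true} * P B + P (B ∩ {ω | R t ω = false}) =
        rewardLaw p {true} * P B + rewardLaw p {false} * P B := by
      rw [hsplit, ← add_mul, hsum, one_mul]
    exact (ENNReal.add_right_inj (ENNReal.mul_ne_top (measure_ne_top _ _)
      (measure_ne_top _ _))).1 this

/-- Induction on `n`: conditionally on the history at the `n`-th selected time, the reward there
equals `y n` with probability `rewardLaw q {y n}`. Only an inequality survives, since there may be
no further selected time. -/
theorem measure_iUnion_selectionEvent_le [IsProbabilityMeasure P] (h : IsBanditRun P μ₁ μ₂ A R)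
    (hp : IsSelection a p) {q : unitInterval} (hq : (q : ℝ) = armMean μ₁ μ₂ a) (y : ℕ → Bool)
    (n : ℕ) :
    P (⋃ t, selectionEvent A R p y n t) ≤ ∏ i ∈ Finset.range n, rewardLaw q {y i} := by
  classical
  induction n with
  | zero => simpa using prob_le_one
  | succ n ih =>
    -- Go back from the selected time of rank `n + 1` to the one of rank `n`, whose reward is
    -- prescribed.
    have hsub : (⋃ t, selectionEvent A R p y (n + 1) t) ⊆
        ⋃ t, selectionEvent A R p y n t ∩ {ω | R t ω = y n} := by
      intro ω hω
      obtain ⟨t, h1, h2, h3⟩ := Set.mem_iUnion.1 hω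
      have hn : ∀ hf : (Set.ofPred (p fun s => A s ω)).Finite, n < hf.toFinset.card := fun hf =>
        lt_of_lt_of_le (by omega) (Nat.count_le_card hf t)
      have hnt : Nat.nth (p fun s => A s ω) n < t := Nat.nth_lt_of_lt_count (by omega)
      have hc := Nat.count_nth hn
      refine Set.mem_iUnion.2 ⟨Nat.nth (p fun s => A s ω) n, ⟨Nat.nth_mem n hn, hc, ?_⟩, ?_⟩
      · exact fun s hs => h3 s (hs.trans hnt)
      · have := h3 _ hnt (Nat.nth_mem n hn)
        rwa [hc] at this
    have hmeas : ∀ t, MeasurableSet (selectionEvent A R p y n t) := fun t =>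
      h.measurableSet_of_history (selectionEvent_of_history hp y n t)
    have hdisj : Pairwise (Function.onFun Disjoint (selectionEvent A R p y n)) := by
      intro s t hst
      refine Set.disjoint_left.2 fun ω hs ht => hst ?_
      exact Nat.count_injective hs.1 ht.1 (hs.2.1.trans ht.2.1.symm)
    calc P (⋃ t, selectionEvent A R p y (n + 1) t)
        ≤ P (⋃ t, selectionEvent A R p y n t ∩ {ω | R t ω = y n}) := measure_mono hsub
      _ ≤ ∑' t, P (selectionEvent A R p y n t ∩ {ω | R t ω = y n}) := measure_iUnion_le _
      _ ≤ ∑' t, rewardLaw q {y n} * P (selectionEvent A R p y n t) := by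
          refine ENNReal.tsum_le_tsum fun t => ?_
          rcases Nat.eq_zero_or_pos t with rfl | ht
          · have : selectionEvent A R p y n 0 = ∅ := by
              ext ω
              simp only [Set.mem_empty_iff_false, iff_false]
              intro hω
              exact absurd (hp.one_le _ _ hω.1) (by norm_num)
            simp [this]
          · exact (h.measure_inter_reward ht hq (selectionEvent_of_history hp y n t)
              (fun ω hω => hp.arm_eq _ _ hω.1) (y n)).le
      _ = rewardLaw q {y n} * P (⋃ t, selectionEvent A R p y n t) := by
          rw [ENNReal.tsum_mul_left, measure_iUnion hdisj hmeas]
      _ ≤ rewardLaw q {y n} * ∏ i ∈ Finset.range n, rewardLaw q {y i} := by gcongr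
      _ = ∏ i ∈ Finset.range (n + 1), rewardLaw q {y i} := by
          rw [Finset.prod_range_succ, mul_comm]

theorem measure_selectedReward_word_le [IsProbabilityMeasure P] (h : IsBanditRun P μ₁ μ₂ A R)
    (hp : IsSelection a p) {q : unitInterval} (hq : (q : ℝ) = armMean μ₁ μ₂ a) (y : ℕ → Bool)
    (n : ℕ) :
    P {ω | (Set.ofPred (p fun s => A s ω)).Infinite ∧
        ∀ i < n, selectedReward A R p ω i = y i} ≤
      ∏ i ∈ Finset.range n, rewardLaw q {y i} := by
  classical
  refine (measure_mono ?_).trans (measure_iUnion_selectionEvent_le h hp hq y n)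
  rintro ω ⟨hinf, hy⟩
  refine Set.mem_iUnion.2 ⟨Nat.nth (p fun s => A s ω) n, Nat.nth_mem_of_infinite hinf n,
    Nat.count_nth_of_infinite hinf n, fun s hs hps => ?_⟩
  have hlt : Nat.count (p fun s => A s ω) s < n := by
    rwa [← Nat.nth_lt_nth hinf, Nat.nth_count hps]
  have := hy _ hlt
  rwa [selectedReward, Nat.nth_count hps] at this

end Rewards

/-! ### Measures on boolean sequences, and measurability of random times -/

/-- A finite measure on boolean sequences is dominated by another one as soon as it is so on the
sets of sequences with a given finite beginning. -/
theorem measure_le_of_words {ν κ : Measure (ℕ → Bool)} [IsFiniteMeasure ν] [IsFiniteMeasure κ]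
    (h : ∀ (y : ℕ → Bool) (n : ℕ), ν {x | ∀ i < n, x i = y i} ≤ κ {x | ∀ i < n, x i = y i}) :
    ν ≤ κ := by
  classical
  -- A cylinder depends on the first `n` coordinates for some `n`, hence is a finite disjoint union
  -- of sets given by words of length `n`.
  have hcyl : ∀ C ∈ measurableCylinders (fun _ : ℕ => Bool), ν C ≤ κ C := by
    intro C hC
    obtain ⟨s, S, hS, rfl⟩ := (mem_measurableCylinders C).1 hC
    obtain ⟨n, hn⟩ : ∃ n, ∀ i ∈ s, i < n :=
      ⟨s.sup id + 1, fun i hi => Nat.lt_succ_of_le (Finset.le_sup (f := id) hi)⟩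
    let H : (ℕ → Bool) → (Fin n → Bool) := fun x i => x i
    have hH : Measurable H := measurable_pi_lambda _ fun i => measurable_pi_apply _
    have hpre : H ⁻¹' (H '' cylinder s S) = cylinder s S := by
      refine Set.Subset.antisymm ?_ (Set.subset_preimage_image _ _)
      rintro x ⟨x', hx', hxx⟩
      rw [mem_cylinder] at hx' ⊢
      convert hx' using 1
      ext i
      exact (congrFun hxx ⟨i, hn i i.2⟩).symm
    set F := (Set.toFinite (H '' cylinder s S)).toFinset with hF
    have hm : ∀ y ∈ F, MeasurableSet (H ⁻¹' {y}) := fun y _ => hH (measurableSet_singleton y)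
    have h1 := sum_measure_preimage_singleton (μ := ν) F hm
    have h2 := sum_measure_preimage_singleton (μ := κ) F hm
    rw [hF, Set.Finite.coe_toFinset, hpre] at h1 h2
    rw [← h1, ← h2]
    refine Finset.sum_le_sum fun w _ => ?_
    have e : H ⁻¹' {w} = {x | ∀ i < n, x i = (fun j => if hj : j < n then w ⟨j, hj⟩ else true) i} := by
      ext x
      simp only [Set.mem_preimage, Set.mem_singleton_iff, Set.mem_ofPred_eq]
      constructor
      · rintro rfl i hi
        simp [H, hi]
      · intro hx
        ext ⟨i, hi⟩
        simpa [hi] using hx i hi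
    rw [e]
    exact h _ n
  refine Measure.le_iff.2 fun S hS => ?_
  refine ENNReal.le_of_forall_pos_le_add fun ε hε _ => ?_
  have hε2 : (0 : ℝ≥0∞) < ε / 2 := by simpa using hε.ne'
  -- Approximating in `ν + κ` controls the symmetric difference for both measures at once.
  obtain ⟨C, hC, hCS⟩ := exists_measure_symmDiff_lt_of_generateFrom_isSetRing (μ := ν + κ)
    isSetRing_measurableCylinders
    ⟨{Set.univ}, Set.countable_singleton _, by
      rw [Set.singleton_subset_iff]; exact univ_mem_measurableCylinders _, by simp⟩
    (generateFrom_measurableCylinders (α := fun _ : ℕ => Bool)).symm hS hε2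
  rw [Measure.add_apply] at hCS
  have h1 : ν S ≤ ν C + ν (symmDiff C S) := by
    refine (measure_mono fun x hx => ?_).trans (measure_union_le _ _)
    by_cases hxC : x ∈ C
    · exact Or.inl hxC
    · exact Or.inr (Or.inr ⟨hx, hxC⟩)
  have h2 : κ C ≤ κ S + κ (symmDiff C S) := by
    refine (measure_mono fun x hx => ?_).trans (measure_union_le _ _)
    by_cases hxS : x ∈ S
    · exact Or.inl hxS
    · exact Or.inr (Or.inl ⟨hx, hxS⟩)
  calc ν S ≤ ν C + ν (symmDiff C S) := h1
    _ ≤ (κ S + κ (symmDiff C S)) + ν (symmDiff C S) := by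
        gcongr
        exact (hcyl C hC).trans h2
    _ ≤ (κ S + ε / 2) + ε / 2 := by
        gcongr
        · exact le_add_self.trans hCS.le
        · exact le_self_add.trans hCS.le
    _ = κ S + ε := by rw [add_assoc, ENNReal.add_halves]

theorem measurable_sInf_nat {Ω : Type*} [MeasurableSpace Ω] {S : Ω → Set ℕ}
    (hS : ∀ n, MeasurableSet {ω | n ∈ S ω}) : Measurable fun ω => sInf (S ω) := by
  refine measurable_to_countable' fun m => ?_
  -- The second piece accounts for the convention `sInf ∅ = 0`.
  have : (fun ω => sInf (S ω)) ⁻¹' {m} =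
      ({ω | m ∈ S ω} ∩ ⋂ k, ⋂ (_ : k < m), {ω | k ∈ S ω}ᶜ) ∪
        ((⋂ k, {ω | k ∈ S ω}ᶜ) ∩ {_ω | m = 0}) := by
    ext ω
    simp only [Set.mem_preimage, Set.mem_singleton_iff, Set.mem_union, Set.mem_inter_iff,
      Set.mem_ofPred_eq, Set.mem_iInter, Set.mem_compl_iff]
    constructor
    · rintro rfl
      by_cases hne : (S ω).Nonempty
      · exact Or.inl ⟨Nat.sInf_mem hne, fun k hk => Nat.notMem_of_lt_sInf hk⟩
      · rw [Set.not_nonempty_iff_eq_empty] at hne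
        simp [hne]
    · rintro (⟨h1, h2⟩ | ⟨h1, rfl⟩)
      · refine le_antisymm (Nat.sInf_le h1) ?_
        by_contra hlt
        exact h2 _ (not_le.1 hlt) (Nat.sInf_mem ⟨m, h1⟩)
      · have : S ω = ∅ := Set.eq_empty_of_forall_notMem h1
        simp [this]
  rw [this]
  refine ((hS m).inter (.iInter fun k => .iInter fun _ => (hS k).compl)).union
    ((MeasurableSet.iInter fun k => (hS k).compl).inter (.const _))

theorem measurable_nth {Ω : Type*} [MeasurableSpace Ω] {p : Ω → ℕ → Prop}
    (hp : ∀ t, MeasurableSet {ω | p ω t}) (n : ℕ) : Measurable fun ω => Nat.nth (p ω) n := by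
  induction n using Nat.strong_induction_on with
  | _ n ih =>
    have e : (fun ω => Nat.nth (p ω) n) =
        fun ω => sInf {x | p ω x ∧ ∀ k < n, Nat.nth (p ω) k < x} :=
      funext fun ω => Nat.nth_eq_sInf (p ω) n
    rw [e]
    refine measurable_sInf_nat fun x => ?_
    have : {ω | x ∈ {x | p ω x ∧ ∀ k < n, Nat.nth (p ω) k < x}} =
        {ω | p ω x} ∩ ⋂ k, ⋂ (_ : k < n), {ω | Nat.nth (p ω) k < x} := by
      ext ω; simp
    rw [this]
    exact (hp x).inter (.iInter fun k => .iInter fun hk => measurableSet_lt (ih k hk) measurable_const)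

theorem measurable_apply_nat {Ω β : Type*} [MeasurableSpace Ω] [MeasurableSpace β]
    {f : ℕ → Ω → β} (hf : ∀ n, Measurable (f n)) {τ : Ω → ℕ} (hτ : Measurable τ) :
    Measurable fun ω => f (τ ω) ω := by
  have h : Measurable fun x : ℕ × Ω => f x.1 x.2 := measurable_from_prod_countable_right hf
  exact h.comp (hτ.prodMk measurable_id)

/-! ### Law of the selected rewards, and the law of large numbers -/

section Law

variable {Ω : Type*} [MeasurableSpace Ω] {P : Measure Ω} {μ₁ μ₂ : ℝ}
  {A : ℕ → Ω → Fin 2} {R : ℕ → Ω → Bool} {a : Fin 2} {p : (ℕ → Fin 2) → ℕ → Prop}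

theorem IsBanditRun.measurableSet_selection (h : IsBanditRun P μ₁ μ₂ A R) (hp : IsSelection a p)
    (t : ℕ) : MeasurableSet {ω | p (fun s => A s ω) t} :=
  h.measurableSet_of_history (t := t) fun _ _ hh hω => (hp.iff_of_history hh le_rfl).1 hω

theorem IsBanditRun.measurable_selectedReward (h : IsBanditRun P μ₁ μ₂ A R)
    (hp : IsSelection a p) : Measurable (selectedReward A R p) :=
  measurable_pi_lambda _ fun n => measurable_apply_nat h.measurable_reward
    (measurable_nth (h.measurableSet_selection hp) n)

theorem measurableSet_infinite_nat {Ω : Type*} [MeasurableSpace Ω] {p : Ω → ℕ → Prop}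
    (hp : ∀ t, MeasurableSet {ω | p ω t}) : MeasurableSet {ω | (Set.ofPred (p ω)).Infinite} := by
  have : {ω | (Set.ofPred (p ω)).Infinite} = ⋂ n, ⋃ m, ⋃ (_ : n < m), {ω | p ω m} := by
    ext ω
    simp only [Set.mem_ofPred_eq, Set.infinite_iff_exists_gt, Set.mem_iInter, Set.mem_iUnion]
    refine forall_congr' fun n => exists_congr fun m => ?_
    simp [and_comm]
  rw [this]
  exact .iInter fun n => .iUnion fun m => .iUnion fun _ => hp m

/-- The rewards collected at infinitely many predictable times are dominated by independent
rewards. -/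
theorem map_selectedReward_le [IsProbabilityMeasure P] (h : IsBanditRun P μ₁ μ₂ A R)
    (hp : IsSelection a p) {q : unitInterval} (hq : (q : ℝ) = armMean μ₁ μ₂ a) :
    (P.restrict {ω | (Set.ofPred (p fun s => A s ω)).Infinite}).map (selectedReward A R p) ≤
      Measure.infinitePi fun _ => rewardLaw q := by
  have hY := h.measurable_selectedReward hp
  have := Measure.isFiniteMeasure_map
    (P.restrict {ω | (Set.ofPred (p fun s => A s ω)).Infinite}) (selectedReward A R p)
  refine measure_le_of_words fun y n => ?_
  have hinf := measurableSet_infinite_nat (h.measurableSet_selection hp)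
  have hw : {x : ℕ → Bool | ∀ i < n, x i = y i} =
      Set.pi (Finset.range n : Set ℕ) (fun i => {y i}) := by
    ext x; simp [Set.mem_pi]
  have hwm : MeasurableSet {x : ℕ → Bool | ∀ i < n, x i = y i} := by
    rw [hw]; exact .pi (Finset.countable_toSet _) fun _ _ => measurableSet_singleton _
  rw [Measure.map_apply hY hwm, Measure.restrict_apply' hinf]
  have hpi : (Measure.infinitePi fun _ : ℕ => rewardLaw q) {x : ℕ → Bool | ∀ i < n, x i = y i} =
      ∏ i ∈ Finset.range n, rewardLaw q {y i} := by
    rw [hw]; exact Measure.infinitePi_pi _ fun _ _ => measurableSet_singleton _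
  rw [hpi]
  refine le_trans (measure_mono ?_) (measure_selectedReward_word_le h hp hq y n)
  rintro ω ⟨h1, h2⟩
  exact ⟨h2, h1⟩

theorem ae_selectedReward [IsProbabilityMeasure P] (h : IsBanditRun P μ₁ μ₂ A R)
    (hp : IsSelection a p) {q : unitInterval} (hq : (q : ℝ) = armMean μ₁ μ₂ a)
    {S : (ℕ → Bool) → Prop} (hS : ∀ᵐ x ∂Measure.infinitePi fun _ : ℕ => rewardLaw q, S x) :
    ∀ᵐ ω ∂P, (Set.ofPred (p fun s => A s ω)).Infinite → S (selectedReward A R p ω) := by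
  have hinf := measurableSet_infinite_nat (h.measurableSet_selection hp)
  have := (Measure.absolutelyContinuous_of_le (map_selectedReward_le h hp hq)).ae_le hS
  exact (ae_restrict_iff' hinf).1 (ae_of_ae_map (h.measurable_selectedReward hp).aemeasurable this)

/-- The domination is now between two probability measures, which forces equality. -/
theorem map_selectedReward_eq [IsProbabilityMeasure P] (h : IsBanditRun P μ₁ μ₂ A R)
    (hp : IsSelection a p) {q : unitInterval} (hq : (q : ℝ) = armMean μ₁ μ₂ a)
    (hinf : ∀ᵐ ω ∂P, (Set.ofPred (p fun s => A s ω)).Infinite) :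
    P.map (selectedReward A R p) = Measure.infinitePi fun _ => rewardLaw q := by
  have hle := map_selectedReward_le h hp hq
  rw [Measure.restrict_eq_self_of_ae_mem
    (s := {ω | (Set.ofPred (p fun s => A s ω)).Infinite}) hinf] at hle
  have := Measure.isProbabilityMeasure_map (μ := P) (h.measurable_selectedReward hp).aemeasurable
  exact Measure.eq_of_le_of_isProbabilityMeasure hle

/-- Strong law of large numbers for boolean rewards. -/
theorem ae_tendsto_average_rewards (q : unitInterval) :
    ∀ᵐ x ∂Measure.infinitePi fun _ : ℕ => rewardLaw q,
      Tendsto (fun n : ℕ => (∑ i ∈ Finset.range n, if x i = true then (1 : ℝ) else 0) / n) atTop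
        (𝓝 q) := by
  set f : Bool → ℝ := fun b => if b = true then 1 else 0
  have hf : Measurable f := measurable_of_finite f
  have hmp : ∀ i : ℕ, MeasurePreserving (fun x : ℕ → Bool => x i)
      (Measure.infinitePi fun _ : ℕ => rewardLaw q) (rewardLaw q) := fun i =>
    measurePreserving_eval_infinitePi (fun _ : ℕ => rewardLaw q) i
  have hind : iIndepFun (fun (i : ℕ) (x : ℕ → Bool) => f (x i))
      (Measure.infinitePi fun _ : ℕ => rewardLaw q) := iIndepFun_infinitePi fun _ => hf
  have hident : ∀ i : ℕ, IdentDistrib (fun x : ℕ → Bool => f (x i)) (fun x => f (x 0))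
      (Measure.infinitePi fun _ : ℕ => rewardLaw q)
      (Measure.infinitePi fun _ : ℕ => rewardLaw q) := fun i =>
    (IdentDistrib.comp ⟨(hmp i).measurable.aemeasurable, (hmp 0).measurable.aemeasurable,
      (hmp i).map_eq.trans (hmp 0).map_eq.symm⟩ hf :)
  have hint : Integrable (fun x : ℕ → Bool => f (x 0))
      (Measure.infinitePi fun _ : ℕ => rewardLaw q) := by
    refine Integrable.of_bound (hf.comp (measurable_pi_apply 0)).aestronglyMeasurable 1
      (ae_of_all _ fun x => ?_)
    simp only [f]; split_ifs <;> simp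
  have hexp : ∫ x, f (x 0) ∂(Measure.infinitePi fun _ : ℕ => rewardLaw q) = q := by
    have : ∫ x, f (x 0) ∂(Measure.infinitePi fun _ : ℕ => rewardLaw q) = ∫ b, f b ∂rewardLaw q := by
      have h1 := integral_map (μ := Measure.infinitePi fun _ : ℕ => rewardLaw q)
        (hmp 0).measurable.aemeasurable hf.aestronglyMeasurable
      rw [(hmp 0).map_eq] at h1
      exact h1.symm
    rw [this, integral_bernoulliMeasure]
    simp [f]
  have := strong_law_ae_real _ hint (fun i j hij => hind.indepFun hij) hident
  rw [hexp] at this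
  exact this

end Law

/-! ## Visits and empirical means along a trajectory -/

section Trajectory

variable {α : ℕ → Fin 2} {r : ℕ → Bool}

theorem visits_succ (α : ℕ → Fin 2) (a : Fin 2) {t : ℕ} (ht : 1 ≤ t) :
    visits α a (t + 1) = visits α a t + if α t = a then 1 else 0 := by
  unfold visits
  rw [← Finset.insert_Ico_right_eq_Ico_add_one ht, Finset.filter_insert]
  split_ifs with h
  · rw [Finset.card_insert_of_notMem (by simp)]
  · rfl

theorem successes_succ (α : ℕ → Fin 2) (r : ℕ → Bool) (a : Fin 2) {t : ℕ} (ht : 1 ≤ t) :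
    successes α r a (t + 1) = successes α r a t + if α t = a ∧ r t = true then 1 else 0 := by
  unfold successes
  rw [← Finset.insert_Ico_right_eq_Ico_add_one ht, Finset.filter_insert]
  split_ifs with h
  · rw [Finset.card_insert_of_notMem (by simp)]
  · rfl

theorem visits_one (α : ℕ → Fin 2) (a : Fin 2) : visits α a 1 = 0 := by simp [visits]

theorem successes_one (α : ℕ → Fin 2) (r : ℕ → Bool) (a : Fin 2) : successes α r a 1 = 0 := by
  simp [successes]

theorem visits_mono (α : ℕ → Fin 2) (a : Fin 2) : Monotone (visits α a) := fun _ _ h =>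
  Finset.card_le_card (Finset.filter_subset_filter _ (Finset.Ico_subset_Ico_right h))

theorem successes_le_visits (α : ℕ → Fin 2) (r : ℕ → Bool) (a : Fin 2) (t : ℕ) :
    successes α r a t ≤ visits α a t :=
  Finset.card_le_card fun i hi => by
    simp only [Finset.mem_filter] at hi ⊢
    exact ⟨hi.1, hi.2.1⟩

theorem visits_le (α : ℕ → Fin 2) (a : Fin 2) (t : ℕ) : visits α a t ≤ t :=
  (Finset.card_filter_le _ _).trans (by simp)

theorem fin_two_eq_or (a b : Fin 2) : b = a ∨ b = 1 - a := by
  revert a b; decide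

theorem one_sub_ne_self (a : Fin 2) : 1 - a ≠ a := by revert a; decide

theorem visits_add_visits (α : ℕ → Fin 2) (a : Fin 2) {t : ℕ} (ht : 1 ≤ t) :
    visits α a t + visits α (1 - a) t + 1 = t := by
  induction t, ht using Nat.le_induction with
  | base => simp [visits_one]
  | succ t ht ih =>
    rw [visits_succ α _ ht, visits_succ α _ ht]
    rcases fin_two_eq_or a (α t) with h | h
    · simp [h, (one_sub_ne_self a).symm]; omega
    · simp [h, one_sub_ne_self a]; omega

theorem empMean_mem (α : ℕ → Fin 2) (r : ℕ → Bool) (a : Fin 2) (t : ℕ) :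
    empMean α r a t ∈ Set.Icc (0 : ℝ) 1 := by
  refine ⟨by unfold empMean; positivity, div_le_one_of_le₀ ?_ (by positivity)⟩
  exact_mod_cast successes_le_visits α r a t

/-- The selection of all the plays of an arm. -/
def playsArm (a : Fin 2) (α : ℕ → Fin 2) (t : ℕ) : Prop := 1 ≤ t ∧ α t = a

instance (a : Fin 2) (α : ℕ → Fin 2) : DecidablePred (playsArm a α) := fun _ =>
  inferInstanceAs (Decidable (_ ∧ _))

theorem isSelection_playsArm (a : Fin 2) : IsSelection a (playsArm a) where
  one_le _ _ h := h.1
  arm_eq _ _ h := h.2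
  congr _ _ t h hp := ⟨hp.1, (h t (Finset.mem_Icc.2 ⟨hp.1, le_rfl⟩)) ▸ hp.2⟩

theorem count_playsArm (α : ℕ → Fin 2) (a : Fin 2) {t : ℕ} (ht : 1 ≤ t) :
    Nat.count (playsArm a α) t = visits α a t := by
  induction t, ht using Nat.le_induction with
  | base => simp [visits_one, Nat.count_succ, playsArm]
  | succ t ht ih => rw [Nat.count_succ, visits_succ α _ ht, ih]; simp [playsArm, ht]

/-- Change of index between times and ranks of selected times; it turns successes into a sum over
the sequence of selected rewards. -/
theorem sum_nth_count (p : ℕ → Prop) [DecidablePred p] (f : ℕ → ℝ) (s h : ℕ) :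
    ∑ j ∈ Finset.Ico (Nat.count p s) (Nat.count p (s + h)), f (Nat.nth p j) =
      ∑ i ∈ Finset.Ico s (s + h), if p i then f i else 0 := by
  induction h with
  | zero => simp
  | succ h ih =>
    rw [← add_assoc, Finset.sum_Ico_succ_top (by omega), ← ih, Nat.count_succ]
    split_ifs with hp
    · rw [Finset.sum_Ico_succ_top (Nat.count_monotone p (by omega)), Nat.nth_count hp]
    · simp

theorem successes_eq_sum (α : ℕ → Fin 2) (r : ℕ → Bool) (a : Fin 2) {t : ℕ} (ht : 1 ≤ t) :
    (successes α r a t : ℝ) =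
      ∑ j ∈ Finset.range (visits α a t),
        if r (Nat.nth (playsArm a α) j) = true then (1 : ℝ) else 0 := by
  have := sum_nth_count (playsArm a α) (fun i => if r i = true then (1 : ℝ) else 0) 0 t
  rw [zero_add, Nat.count_zero, count_playsArm α a ht, ← Finset.range_eq_Ico] at this
  rw [this]
  clear this
  induction t, ht using Nat.le_induction with
  | base => simp [successes_one, playsArm]
  | succ t ht ih =>
    rw [successes_succ α r a ht, Finset.sum_Ico_succ_top (by omega), ← ih]
    simp only [playsArm, ht, true_and, Nat.cast_add, Nat.cast_ite, Nat.cast_one, Nat.cast_zero]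
    congr 1
    split_ifs <;> simp_all

theorem tendsto_visits_of_infinite {a : Fin 2} (h : (Set.ofPred (playsArm a α)).Infinite) :
    Tendsto (visits α a) atTop atTop := by
  have hc : Tendsto (Nat.count (playsArm a α)) atTop atTop := by
    refine tendsto_atTop_atTop.2 fun b => ⟨Nat.nth (playsArm a α) b, fun t ht => ?_⟩
    rw [← Nat.count_nth_of_infinite h b]
    exact Nat.count_monotone _ ht
  exact hc.congr' ((eventually_ge_atTop 1).mono fun t ht => count_playsArm α a ht)

theorem tendsto_empMean_of_tendsto_average {a : Fin 2} {q : ℝ}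
    (h : (Set.ofPred (playsArm a α)).Infinite)
    (hq : Tendsto (fun n : ℕ => (∑ j ∈ Finset.range n,
      if r (Nat.nth (playsArm a α) j) = true then (1 : ℝ) else 0) / n) atTop (𝓝 q)) :
    Tendsto (empMean α r a) atTop (𝓝 q) := by
  refine (hq.comp (tendsto_visits_of_infinite h)).congr' ?_
  filter_upwards [eventually_ge_atTop 1] with t ht
  simp only [Function.comp, empMean, successes_eq_sum α r a ht]

theorem visits_eq_of_forall {a : Fin 2} {s : ℕ} (hs : 1 ≤ s) (h : ℕ)
    (hα : ∀ i < h, α (s + i) = a) : visits α a (s + h) = visits α a s + h := by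
  induction h with
  | zero => rfl
  | succ h ih =>
    rw [← add_assoc, visits_succ α a (by omega), ih fun i hi => hα i (by omega),
      if_pos (hα h (by omega)), add_assoc]

theorem visits_eq_of_forall_ne {a : Fin 2} {s : ℕ} (hs : 1 ≤ s) (h : ℕ)
    (hα : ∀ i < h, α (s + i) ≠ a) : visits α a (s + h) = visits α a s := by
  induction h with
  | zero => rfl
  | succ h ih =>
    rw [← add_assoc, visits_succ α a (by omega), ih fun i hi => hα i (by omega),
      if_neg (hα h (by omega)), add_zero]

theorem successes_eq_of_forall_ne {a : Fin 2} {s : ℕ} (hs : 1 ≤ s) (h : ℕ)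
    (hα : ∀ i < h, α (s + i) ≠ a) : successes α r a (s + h) = successes α r a s := by
  induction h with
  | zero => rfl
  | succ h ih =>
    rw [← add_assoc, successes_succ α r a (by omega), ih fun i hi => hα i (by omega),
      if_neg fun hh => (hα h (by omega)) hh.1, add_zero]

theorem successes_eq_of_forall {a : Fin 2} {s : ℕ} (hs : 1 ≤ s) (h : ℕ)
    (hα : ∀ i < h, α (s + i) = a) :
    (successes α r a (s + h) : ℝ) =
      successes α r a s + ∑ i ∈ Finset.range h, if r (s + i) = true then (1 : ℝ) else 0 := by
  induction h with
  | zero => simp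
  | succ h ih =>
    rw [← add_assoc, successes_succ α r a (by omega), Nat.cast_add,
      ih fun i hi => hα i (by omega), Finset.sum_range_succ, hα h (by omega), add_assoc]
    simp

theorem empMean_eq_of_forall_ne {a : Fin 2} {s : ℕ} (hs : 1 ≤ s) (h : ℕ)
    (hα : ∀ i < h, α (s + i) ≠ a) : empMean α r a (s + h) = empMean α r a s := by
  unfold empMean
  rw [successes_eq_of_forall_ne hs h hα, visits_eq_of_forall_ne hs h hα]

end Trajectory

/-! ### Typical trajectories, and infinitely many plays of both arms -/

/-- A trajectory of an index policy along which the law of large numbers holds. -/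
structure IsTypical (I : ℝ → ℝ → ℝ → ℝ → ℝ≥0∞) (μ₁ μ₂ : ℝ) (α : ℕ → Fin 2) (r : ℕ → Bool) :
    Prop where
  follows : ∀ t, 1 ≤ t → ∀ b : Fin 2, armIndex I α r b t ≤ armIndex I α r (α t) t
  tendsto_empMean : ∀ a, (Set.ofPred (playsArm a α)).Infinite →
    Tendsto (empMean α r a) atTop (𝓝 (armMean μ₁ μ₂ a))

theorem ae_isTypical {Ω : Type*} [MeasurableSpace Ω] {P : Measure Ω} [IsProbabilityMeasure P]
    {μ₁ μ₂ : ℝ} (hμ₂ : 0 < μ₂) (hμ : μ₂ < μ₁) (hμ₁ : μ₁ < 1) {I : ℝ → ℝ → ℝ → ℝ → ℝ≥0∞}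
    {A : ℕ → Ω → Fin 2} {R : ℕ → Ω → Bool} (hrun : IsBanditRun P μ₁ μ₂ A R)
    (hindex : FollowsIndex P I A R) :
    ∀ᵐ ω ∂P, IsTypical I μ₁ μ₂ (fun t => A t ω) (fun t => R t ω) := by
  have hmem : ∀ a, armMean μ₁ μ₂ a ∈ unitInterval := by
    intro a
    fin_cases a
    · exact ⟨(hμ₂.trans hμ).le, hμ₁.le⟩
    · exact ⟨hμ₂.le, (hμ.trans hμ₁).le⟩
  have h : ∀ a, ∀ᵐ ω ∂P, _ := fun a => ae_selectedReward hrun (isSelection_playsArm a)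
    (q := ⟨armMean μ₁ μ₂ a, hmem a⟩) rfl (ae_tendsto_average_rewards _)
  filter_upwards [hindex, ae_all_iff.2 h] with ω h1 h2
  exact ⟨h1, fun a ha => tendsto_empMean_of_tendsto_average ha (h2 a ha)⟩

section Regime

variable {I : ℝ → ℝ → ℝ → ℝ → ℝ≥0∞} {Imax : ℝ≥0∞} {μ₁ μ₂ L ρ : ℝ} {α : ℕ → Fin 2} {r : ℕ → Bool}

theorem armMean_le (hμ : μ₂ < μ₁) (a : Fin 2) : armMean μ₁ μ₂ a ≤ μ₁ := by
  fin_cases a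
  · exact le_rfl
  · exact hμ.le

theorem isEquivalent_natCast_of_sub {m : ℕ → ℝ}
    (h : (fun t : ℕ => m t - t) =o[atTop] fun t : ℕ => (t : ℝ)) : m ~[atTop] fun t => (t : ℝ) := h

/-- If arm `a` were abandoned, the other arm would be played linearly often and keep its index below
some `c < Imax`, while the index of `a`, with frozen visits and frozen mean, would tend to `Imax`;
the policy would then return to `a`. -/
theorem IsTypical.infinite_plays (hI : IsRegularIndex I Imax μ₁ μ₂ L ρ) (hμ₂ : 0 < μ₂)
    (hμ : μ₂ < μ₁) (hμ₁ : μ₁ < 1) (h : IsTypical I μ₁ μ₂ α r) (a : Fin 2) :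
    (Set.ofPred (playsArm a α)).Infinite := by
  intro hfin
  have hμ1pos : 0 < μ₁ := hμ₂.trans hμ
  have hμ1mem : μ₁ ∈ Set.Icc (0 : ℝ) 1 := ⟨hμ1pos.le, hμ₁.le⟩
  obtain ⟨s, hs1, hs⟩ : ∃ s, 1 ≤ s ∧ ∀ t, s ≤ t → α t = 1 - a := by
    obtain ⟨M, hM⟩ := hfin.bddAbove
    refine ⟨M + 1, by omega, fun t ht => ?_⟩
    rcases fin_two_eq_or a (α t) with h1 | h1
    · exact absurd (hM (show playsArm a α t from ⟨by omega, h1⟩)) (by omega)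
    · exact h1
  set b := 1 - a with hb
  have hba : 1 - b = a := by rw [hb, sub_sub_cancel]
  have hbinf : (Set.ofPred (playsArm b α)).Infinite := by
    refine Set.infinite_of_forall_exists_gt fun n => ⟨max s (n + 1), ⟨?_, hs _ (le_max_left _ _)⟩, ?_⟩
    · omega
    · omega
  have hne : ∀ t, s ≤ t → ∀ i < t - s, α (s + i) ≠ a := fun t _ i _ => by
    rw [hs (s + i) (by omega)]; exact one_sub_ne_self a
  have hN : ∀ t, s ≤ t → visits α a t = visits α a s := fun t ht => by
    have := visits_eq_of_forall_ne hs1 (t - s) (hne t ht)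
    rwa [Nat.add_sub_cancel' ht] at this
  have hν : ∀ t, s ≤ t → empMean α r a t = empMean α r a s := fun t ht => by
    have := empMean_eq_of_forall_ne (r := r) hs1 (t - s) (hne t ht)
    rwa [Nat.add_sub_cancel' ht] at this
  set n := visits α a s
  set ν := empMean α r a s
  have hνmem : ν ∈ Set.Icc (0 : ℝ) 1 := empMean_mem α r a s
  -- The assumptions only speak of a surviving arm whose mean is near `μ₁`, but `b` may be the
  -- suboptimal arm. Raising its mean to at least `μ₁` raises its index and, seen as the
  -- competitor's mean, lowers the index of `a`, so both bounds transfer by monotonicity.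
  set x : ℕ → ℝ := fun t => max (empMean α r b t) μ₁ with hx
  have hxmem : ∀ t, x t ∈ Set.Icc (0 : ℝ) 1 := fun t =>
    ⟨(empMean_mem α r b t).1.trans (le_max_left _ _), max_le (empMean_mem α r b t).2 hμ₁.le⟩
  have hxt : Tendsto x atTop (𝓝 μ₁) := by
    have := (h.tendsto_empMean b hbinf).max (tendsto_const_nhds (x := μ₁))
    rwa [max_eq_right (armMean_le hμ b)] at this
  have hxe : x ~[atTop] fun _ => μ₁ := (isEquivalent_const_iff_tendsto hμ1pos.ne').2 hxt
  have hvb : ∀ t, s ≤ t → (visits α b t : ℝ) = t - 1 - n := fun t ht => by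
    have := visits_add_visits α a (t := t) (by omega)
    rw [hN t ht] at this
    have h2 : (n : ℝ) + visits α b t + 1 = t := by exact_mod_cast this
    linarith
  have hvbe : (fun t => max 1 (visits α b t : ℝ)) ~[atTop] fun t : ℕ => (t : ℝ) := by
    have h1 : (fun t : ℕ => (t : ℝ) + (-1 - n)) ~[atTop] fun t : ℕ => (t : ℝ) := by
      refine isEquivalent_natCast_of_sub ?_
      simp only [add_sub_cancel_left]
      exact isLittleO_const_left.2 (Or.inr (tendsto_norm_atTop_atTop.comp
        tendsto_natCast_atTop_atTop))
    refine h1.congr_left ?_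
    filter_upwards [eventually_ge_atTop s, eventually_ge_atTop (n + 2)] with t ht ht2
    rw [hvb t ht, max_eq_right]
    · ring
    · have : ((n + 2 : ℕ) : ℝ) ≤ t := by exact_mod_cast ht2
      push_cast at this; linarith
  obtain ⟨c, hc, hcb⟩ := hI.bounded_away ν hνmem
  have hup := hcb x (fun _ => ν) (fun t => max 1 (visits α b t : ℝ)) hxmem (fun _ => hνmem)
    (fun t => le_max_left _ _) hxe IsEquivalent.refl hvbe
  have hup' : ∀ᶠ t in atTop, armIndex I α r b t ≤ c := by
    filter_upwards [hup, eventually_ge_atTop s, eventually_ge_atTop (n + 2)] with t h1 ht ht2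
    have hv1 : (1 : ℝ) ≤ visits α b t := by
      rw [hvb t ht]
      have : ((n + 2 : ℕ) : ℝ) ≤ t := by exact_mod_cast ht2
      push_cast at this; linarith
    have hv : visits α b t ≠ 0 := by
      intro h0; rw [h0] at hv1; norm_num at hv1
    have ht1 : (1 : ℝ) ≤ t := by exact_mod_cast hs1.trans ht
    rw [armIndex, if_neg hv, hba, hν t ht]
    refine le_trans ?_ h1
    rw [max_eq_right hv1]
    exact hI.mono _ (empMean_mem _ _ _ _) _ (hxmem t) _ hνmem _ hνmem _ _ _ _ hv1 hv1 ht1 ht1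
      (le_max_left _ _) le_rfl le_rfl le_rfl
  have hlow : ∀ᶠ t in atTop, armIndex I α r a t ≤ c := by
    filter_upwards [hup', eventually_ge_atTop s] with t h1 ht
    have := h.follows t (hs1.trans ht) a
    rw [hs t ht] at this
    exact this.trans h1
  -- Divergence is assumed for `n ≥ 1` only; an arm never visited has index `⊤`, which already
  -- exceeds `c`.
  rcases Nat.eq_zero_or_pos n with hn | hn
  · obtain ⟨t, h1, ht⟩ := (hlow.and (eventually_ge_atTop s)).exists
    rw [armIndex, if_pos (by rw [hN t ht, hn])] at h1
    exact absurd (lt_of_le_of_lt h1 hc) not_top_lt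
  · have hn1 : (1 : ℝ) ≤ n := by exact_mod_cast hn
    have hlim := hI.diverges n hn ν hνmem (fun _ => ν) x (fun _ => n) (fun _ => hνmem) hxmem
      (fun _ => hn1) IsEquivalent.refl hxe IsEquivalent.refl
    obtain ⟨t, h1, h2, ht⟩ := ((hlim.eventually_const_lt hc).and
      (hlow.and (eventually_ge_atTop s))).exists
    have ht1 : (1 : ℝ) ≤ t := by exact_mod_cast hs1.trans ht
    rw [armIndex, if_neg (by rw [hN t ht]; omega), hN t ht, hν t ht, ← hb] at h2
    refine absurd (h1.trans_le (le_trans ?_ h2)) (lt_irrefl _)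
    exact hI.mono _ hνmem _ hνmem _ (hxmem t) _ (empMean_mem _ _ _ _) _ _ _ _ hn1 hn1 ht1 ht1
      le_rfl (le_max_left _ _) le_rfl le_rfl

end Regime

/-! ## The asymptotic regime -/

section Inverse

variable {I : ℝ → ℝ → ℝ → ℝ → ℝ≥0∞} {Imax : ℝ≥0∞} {μ₁ μ₂ L ρ : ℝ}

theorem inverseVisits_spec {ν₁ ν₂ x t : ℝ} (h : ∃! n : ℝ, 1 ≤ n ∧ I ν₂ ν₁ n t = ENNReal.ofReal x) :
    1 ≤ inverseVisits I ν₁ ν₂ x t ∧ I ν₂ ν₁ (inverseVisits I ν₁ ν₂ x t) t = ENNReal.ofReal x ∧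
      ∀ n, 1 ≤ n → I ν₂ ν₁ n t = ENNReal.ofReal x → n = inverseVisits I ν₁ ν₂ x t := by
  obtain ⟨n, ⟨h1, h2⟩, _⟩ := id h
  have he : ∃ n ∈ Set.Ici (1 : ℝ), (fun n : ℝ => I ν₂ ν₁ n t) n = ENNReal.ofReal x := ⟨n, h1, h2⟩
  have hm := Function.invFunOn_mem he
  have hq := Function.invFunOn_eq he
  exact ⟨hm, hq, fun n hn hnx => h.unique ⟨hn, hnx⟩ ⟨hm, hq⟩⟩

theorem inverseVisits_const_spec (hI : IsRegularIndex I Imax μ₁ μ₂ L ρ) (hμ₂ : 0 < μ₂)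
    (hμ₁ : 0 < μ₁) :
    ∀ᶠ t : ℝ in atTop, 1 ≤ inverseVisits I μ₁ μ₂ L t ∧
      I μ₂ μ₁ (inverseVisits I μ₁ μ₂ L t) t = ENNReal.ofReal L ∧
      ∀ n, 1 ≤ n → I μ₂ μ₁ n t = ENNReal.ofReal L → n = inverseVisits I μ₁ μ₂ L t := by
  obtain ⟨ε, hε, h1, _⟩ := hI.inverse
  have hL := hI.limit_pos
  filter_upwards [h1] with t ht
  exact inverseVisits_spec (ht _ _ _ (by simpa using mul_pos hε hμ₁)
    (by simpa using mul_pos hε hμ₂) (by simpa using mul_pos hε hL))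

/-- If `n₂ s > n₂ t` with `s ≤ t`, monotonicity in visits and in time squeezes the index at `(n₂ s,
t)` between `L` and `L`, against uniqueness of the inverse. -/
theorem inverseVisits_mono (hI : IsRegularIndex I Imax μ₁ μ₂ L ρ) (hμ₂ : 0 < μ₂) (hμ : μ₂ < μ₁)
    (hμ₁ : μ₁ < 1) :
    ∃ T₀ : ℝ, 1 ≤ T₀ ∧ ∀ s t : ℝ, T₀ ≤ s → s ≤ t →
      inverseVisits I μ₁ μ₂ L s ≤ inverseVisits I μ₁ μ₂ L t := by
  have hμ1mem : μ₁ ∈ Set.Icc (0 : ℝ) 1 := ⟨(hμ₂.trans hμ).le, hμ₁.le⟩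
  have hμ2mem : μ₂ ∈ Set.Icc (0 : ℝ) 1 := ⟨hμ₂.le, (hμ.trans hμ₁).le⟩
  obtain ⟨T₀, hT₀⟩ := eventually_atTop.1 (inverseVisits_const_spec hI hμ₂ (hμ₂.trans hμ))
  refine ⟨max T₀ 1, le_max_right _ _, fun s t hs hst => ?_⟩
  obtain ⟨s1, s2, _⟩ := hT₀ s ((le_max_left _ _).trans hs)
  obtain ⟨t1, t2, t3⟩ := hT₀ t ((le_max_left _ _).trans (hs.trans hst))
  have hs1 : 1 ≤ s := (le_max_right _ _).trans hs
  by_contra! hlt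
  have h1 : I μ₂ μ₁ (inverseVisits I μ₁ μ₂ L s) t ≤ ENNReal.ofReal L := by
    rw [← t2]
    exact hI.mono _ hμ2mem _ hμ2mem _ hμ1mem _ hμ1mem _ _ _ _ s1 t1 (hs1.trans hst)
      (hs1.trans hst) le_rfl le_rfl hlt.le le_rfl
  have h2 : ENNReal.ofReal L ≤ I μ₂ μ₁ (inverseVisits I μ₁ μ₂ L s) t := by
    rw [← s2]
    exact hI.mono _ hμ2mem _ hμ2mem _ hμ1mem _ hμ1mem _ _ _ _ s1 s1 hs1 (hs1.trans hst)
      le_rfl le_rfl le_rfl hst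
  exact hlt.ne' (t3 _ s1 (le_antisymm h1 h2))

theorem eventually_abs_sub_lt_of_tendsto {ν : ℕ → ℝ} {μ ε : ℝ} (h : Tendsto ν atTop (𝓝 μ))
    (hε : 0 < ε) : ∀ᶠ t in atTop, |ν t - μ| < ε := by
  simpa [Real.dist_eq] using Metric.tendsto_nhds.1 h ε hε

theorem Asymptotics.IsEquivalent.eventually_abs_sub_le {u v : ℕ → ℝ} (h : u ~[atTop] v) {ε : ℝ}
    (hε : 0 < ε) : ∀ᶠ t in atTop, |u t - v t| ≤ ε * |v t| := by
  simpa using h.isLittleO.def hε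

/-- The index of the suboptimal arm is away from its limit when its number of visits is not
equivalent to the expected one. -/
theorem index_away (hI : IsRegularIndex I Imax μ₁ μ₂ L ρ) (hμ₂ : 0 < μ₂) (hμ : μ₂ < μ₁)
    (hμ₁ : μ₁ < 1) {ν₁ ν₂ : ℕ → ℝ} (h1 : ∀ t, ν₁ t ∈ Set.Icc (0 : ℝ) 1)
    (h2 : ∀ t, ν₂ t ∈ Set.Icc (0 : ℝ) 1) (hν₁ : Tendsto ν₁ atTop (𝓝 μ₁))
    (hν₂ : Tendsto ν₂ atTop (𝓝 μ₂)) {ε : ℝ} (hε : 0 < ε) (hε1 : ε < 1) :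
    ∃ η > 0, ∀ᶠ t : ℕ in atTop,
      ENNReal.ofReal ((1 + η) * L) ≤ I (ν₂ t) (ν₁ t) ((1 - ε) * inverseVisits I μ₁ μ₂ L t) t ∧
      I (ν₂ t) (ν₁ t) ((1 + ε) * inverseVisits I μ₁ μ₂ L t) t ≤ ENNReal.ofReal ((1 - η) * L) := by
  have hμ1pos : 0 < μ₁ := hμ₂.trans hμ
  have hμ1mem : μ₁ ∈ Set.Icc (0 : ℝ) 1 := ⟨hμ1pos.le, hμ₁.le⟩
  have hμ2mem : μ₂ ∈ Set.Icc (0 : ℝ) 1 := ⟨hμ₂.le, (hμ.trans hμ₁).le⟩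
  have hL := hI.limit_pos
  obtain ⟨ε₀, hε₀, hinv, heq⟩ := hI.inverse
  obtain ⟨ℓ, -, hℓ, hmono⟩ := hI.asymp_mono
  have hℓ3 := hℓ (ε / 3) (by linarith)
  -- Asymptotic monotonicity is used at the true means, where the index at `n₂` is exactly `L`. Its
  -- consequence is carried to the empirical means through the equivalence of the inverses at the
  -- levels `(1 ± η) L`.
  obtain ⟨hA, hB⟩ := hmono (fun _ => μ₁) (fun _ => μ₂) IsEquivalent.refl IsEquivalent.refl
  -- Below `ℓ (ε / 3)` for strict comparisons, below `ε₀` so that the levels `(1 ± η) L` are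
  -- invertible, below `1` so that `(1 - η) L > 0`.
  set η := min (min (ℓ (ε / 3)) ε₀) 1 / 2 with hη
  have hη0 : 0 < η := by positivity
  have hηℓ : η < ℓ (ε / 3) := by
    have : min (min (ℓ (ε / 3)) ε₀) 1 ≤ ℓ (ε / 3) := (min_le_left _ _).trans (min_le_left _ _)
    linarith
  have hηε : η < ε₀ := by
    have : min (min (ℓ (ε / 3)) ε₀) 1 ≤ ε₀ := (min_le_left _ _).trans (min_le_right _ _)
    linarith
  have hη1 : η < 1 := by
    have : min (min (ℓ (ε / 3)) ε₀) 1 ≤ 1 := min_le_right _ _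
    linarith
  have hn₂ : Tendsto (fun t : ℕ => inverseVisits I μ₁ μ₂ L t) atTop atTop :=
    hI.tendsto_visits.comp tendsto_natCast_atTop_atTop
  have c1 := eventually_abs_sub_lt_of_tendsto hν₁ (mul_pos hε₀ hμ1pos)
  have c2 := eventually_abs_sub_lt_of_tendsto hν₂ (mul_pos hε₀ hμ₂)
  have c1' : |μ₁ - μ₁| < ε₀ * μ₁ := by simpa using mul_pos hε₀ hμ1pos
  have c2' : |μ₂ - μ₂| < ε₀ * μ₂ := by simpa using mul_pos hε₀ hμ₂
  have e1 : ν₁ ~[atTop] fun _ => μ₁ := (isEquivalent_const_iff_tendsto hμ1pos.ne').2 hν₁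
  have e2 : ν₂ ~[atTop] fun _ => μ₂ := (isEquivalent_const_iff_tendsto hμ₂.ne').2 hν₂
  have key : ∀ x : ℝ, |x - L| < ε₀ * L →
      (fun t : ℕ => inverseVisits I (ν₁ t) (ν₂ t) x t) ~[atTop]
        fun t : ℕ => inverseVisits I μ₁ μ₂ x t := fun x hx =>
    heq (fun _ => μ₁) (fun _ => μ₂) (fun _ => x) ν₁ ν₂ (fun _ => x)
      (Eventually.of_forall fun _ => ⟨c1', c2', hx⟩)
      (by filter_upwards [c1, c2] with t a b using ⟨a, b, hx⟩) e1 e2 IsEquivalent.refl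
  have x1 : |(1 + η) * L - L| < ε₀ * L := by
    have : (1 + η) * L - L = η * L := by ring
    rw [this, abs_of_pos (by positivity)]
    exact mul_lt_mul_of_pos_right hηε hL
  have x2 : |(1 - η) * L - L| < ε₀ * L := by
    have : (1 - η) * L - L = -(η * L) := by ring
    rw [this, abs_neg, abs_of_pos (by positivity)]
    exact mul_lt_mul_of_pos_right hηε hL
  have hinvN := tendsto_natCast_atTop_atTop.eventually hinv
  have hspecN := tendsto_natCast_atTop_atTop.eventually (inverseVisits_const_spec hI hμ₂ hμ1pos)
  refine ⟨η, hη0, ?_⟩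
  filter_upwards [c1, c2, hinvN, hspecN, hA (ε / 3) (by linarith),
    hB (ε / 3) (by linarith) (by linarith), (key _ x1).eventually_abs_sub_le (ε := ε / 3)
    (by linarith), (key _ x2).eventually_abs_sub_le (ε := ε / 3) (by linarith),
    hn₂.eventually_ge_atTop (1 / (1 - ε)), eventually_ge_atTop 1] with t c1 c2 hi hs hA hB k1 k2
    hn ht
  have ht1 : (1 : ℝ) ≤ t := by exact_mod_cast ht
  obtain ⟨s1, s2, -⟩ := hs
  set n₂ := inverseVisits I μ₁ μ₂ L t
  rw [s2] at hA hB
  have hn1 : 1 ≤ (1 - ε) * n₂ := by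
    rw [div_le_iff₀ (by linarith)] at hn; linarith
  constructor
  · obtain ⟨f1, f2, -⟩ := inverseVisits_spec (hi _ _ _ c1' c2' x1)
    obtain ⟨g1, g2, -⟩ := inverseVisits_spec (hi _ _ _ c1 c2 x1)
    set f := inverseVisits I μ₁ μ₂ ((1 + η) * L) t
    set g := inverseVisits I (ν₁ t) (ν₂ t) ((1 + η) * L) t
    have hf : (1 - ε / 3) * n₂ ≤ f := by
      by_contra! hlt
      have h3 : I μ₂ μ₁ ((1 - ε / 3) * n₂) t ≤ I μ₂ μ₁ f t :=
        hI.mono _ hμ2mem _ hμ2mem _ hμ1mem _ hμ1mem _ _ _ _ (f1.trans hlt.le) f1 ht1 ht1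
          le_rfl le_rfl hlt.le le_rfl
      rw [f2] at h3
      rw [← ENNReal.ofReal_mul (by linarith)] at hB
      have h4 := (ENNReal.ofReal_le_ofReal_iff (by positivity)).1 (hB.trans h3)
      have := mul_lt_mul_of_pos_right hηℓ hL
      linarith
    rw [abs_of_pos (by linarith : 0 < f)] at k1
    -- One factor `1 - ε / 3` comes from `f` against `n₂`, the other from `g` against `f`; their
    -- product is at least `1 - ε`.
    have hg : (1 - ε) * n₂ ≤ g := by
      have h3 := (abs_le.1 k1).1
      have h4 : (1 - ε / 3) * ((1 - ε / 3) * n₂) ≤ (1 - ε / 3) * f :=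
        mul_le_mul_of_nonneg_left hf (by linarith)
      have h5 : 0 ≤ ε * n₂ := by positivity
      have h6 : 0 ≤ ε * (ε * n₂) := by positivity
      linarith
    rw [← g2]
    exact hI.mono _ (h2 t) _ (h2 t) _ (h1 t) _ (h1 t) _ _ _ _ g1 hn1 ht1 ht1 le_rfl le_rfl hg le_rfl
  · obtain ⟨f1, f2, -⟩ := inverseVisits_spec (hi _ _ _ c1' c2' x2)
    obtain ⟨g1, g2, -⟩ := inverseVisits_spec (hi _ _ _ c1 c2 x2)
    set f := inverseVisits I μ₁ μ₂ ((1 - η) * L) t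
    set g := inverseVisits I (ν₁ t) (ν₂ t) ((1 - η) * L) t
    have hf : f ≤ (1 + ε / 3) * n₂ := by
      by_contra! hlt
      have h3 : I μ₂ μ₁ f t ≤ I μ₂ μ₁ ((1 + ε / 3) * n₂) t :=
        hI.mono _ hμ2mem _ hμ2mem _ hμ1mem _ hμ1mem _ _ _ _ f1 (by nlinarith) ht1 ht1
          le_rfl le_rfl hlt.le le_rfl
      rw [f2] at h3
      have h4 := h3.trans hA
      -- If `ℓ (ε / 3) ≥ 1`, `ENNReal.ofReal` truncates the factor to `0`, which would make a
      -- positive level vanish.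
      rcases le_total (1 - ℓ (ε / 3)) 0 with h0 | h0
      · rw [ENNReal.ofReal_of_nonpos h0, zero_mul] at h4
        have h5 := ENNReal.ofReal_eq_zero.1 (le_antisymm h4 bot_le)
        have : 0 < (1 - η) * L := mul_pos (by linarith) hL
        linarith
      · rw [← ENNReal.ofReal_mul h0] at h4
        have h4 := (ENNReal.ofReal_le_ofReal_iff (by positivity)).1 h4
        have := mul_lt_mul_of_pos_right hηℓ hL
        linarith
    rw [abs_of_pos (by linarith : 0 < f)] at k2
    have hg : g ≤ (1 + ε) * n₂ := by
      have h3 := (abs_le.1 k2).2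
      nlinarith
    rw [← g2]
    exact hI.mono _ (h2 t) _ (h2 t) _ (h1 t) _ (h1 t) _ _ _ _ (by nlinarith) g1 ht1 ht1
      le_rfl le_rfl hg le_rfl

end Inverse

/-! ### The number of visits of arm 2 is equivalent to `n₂` -/

section Regime

variable {I : ℝ → ℝ → ℝ → ℝ → ℝ≥0∞} {Imax : ℝ≥0∞} {μ₁ μ₂ L ρ : ℝ} {α : ℕ → Fin 2} {r : ℕ → Bool}

theorem armIndex_zero {t : ℕ} (h : visits α 0 t ≠ 0) :
    armIndex I α r 0 t = I (empMean α r 0 t) (empMean α r 1 t) (visits α 0 t) t := by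
  rw [armIndex, if_neg h]; rfl

theorem armIndex_one {t : ℕ} (h : visits α 1 t ≠ 0) :
    armIndex I α r 1 t = I (empMean α r 1 t) (empMean α r 0 t) (visits α 1 t) t := by
  rw [armIndex, if_neg h]; rfl

theorem IsTypical.tendsto_visits (hI : IsRegularIndex I Imax μ₁ μ₂ L ρ) (hμ₂ : 0 < μ₂)
    (hμ : μ₂ < μ₁) (hμ₁ : μ₁ < 1) (h : IsTypical I μ₁ μ₂ α r) (a : Fin 2) :
    Tendsto (visits α a) atTop atTop :=
  tendsto_visits_of_infinite (h.infinite_plays hI hμ₂ hμ hμ₁ a)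

theorem IsTypical.tendsto_mean (hI : IsRegularIndex I Imax μ₁ μ₂ L ρ) (hμ₂ : 0 < μ₂)
    (hμ : μ₂ < μ₁) (hμ₁ : μ₁ < 1) (h : IsTypical I μ₁ μ₂ α r) (a : Fin 2) :
    Tendsto (empMean α r a) atTop (𝓝 (armMean μ₁ μ₂ a)) :=
  h.tendsto_empMean a (h.infinite_plays hI hμ₂ hμ hμ₁ a)

/-- With too many visits, the index of arm 2 falls below `(1 - η) L`, whereas that of arm 1 is
eventually larger. -/
theorem IsTypical.visits_le_of_play (hI : IsRegularIndex I Imax μ₁ μ₂ L ρ) (hμ₂ : 0 < μ₂)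
    (hμ : μ₂ < μ₁) (hμ₁ : μ₁ < 1) (h : IsTypical I μ₁ μ₂ α r) {ε : ℝ} (hε : 0 < ε)
    (hε1 : ε < 1) :
    ∀ᶠ t : ℕ in atTop, α t = 1 → (visits α 1 t : ℝ) ≤ (1 + ε) * inverseVisits I μ₁ μ₂ L t := by
  have hμ1pos : 0 < μ₁ := hμ₂.trans hμ
  have m0 := h.tendsto_mean hI hμ₂ hμ hμ₁ 0
  have m1 := h.tendsto_mean hI hμ₂ hμ hμ₁ 1
  obtain ⟨η, hη, hev⟩ := index_away hI hμ₂ hμ hμ₁ (empMean_mem α r 0) (empMean_mem α r 1) m0 m1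
    hε hε1
  -- The visits of arm 1 are not yet known to be equivalent to `t`. They are at most `t`, and
  -- evaluating at `t` visits gives the lower bound on the index that is needed.
  have hlim := hI.converges (empMean α r 0) (empMean α r 1) (fun t : ℕ => max 1 (t : ℝ))
    (empMean_mem α r 0) (empMean_mem α r 1) (fun t => le_max_left _ _)
    ((isEquivalent_const_iff_tendsto hμ1pos.ne').2 m0)
    ((isEquivalent_const_iff_tendsto hμ₂.ne').2 m1)
    (IsEquivalent.refl.congr_left ((eventually_ge_atTop 1).mono fun t ht =>
      (max_eq_right (show (1 : ℝ) ≤ t by exact_mod_cast ht)).symm))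
  have hlt : ENNReal.ofReal ((1 - η) * L) < ENNReal.ofReal L :=
    (ENNReal.ofReal_lt_ofReal_iff hI.limit_pos).2 (by nlinarith [hI.limit_pos])
  filter_upwards [hev, hlim.eventually_const_lt hlt, eventually_ge_atTop 1,
    (h.tendsto_visits hI hμ₂ hμ hμ₁ 0).eventually_ge_atTop 1,
    (h.tendsto_visits hI hμ₂ hμ hμ₁ 1).eventually_ge_atTop 1,
    tendsto_natCast_atTop_atTop.eventually (inverseVisits_const_spec hI hμ₂ hμ1pos)]
    with t h1 h2 ht v0 v1 hn hα
  by_contra! hgt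
  have ht1 : (1 : ℝ) ≤ t := by exact_mod_cast ht
  have v0' : (1 : ℝ) ≤ visits α 0 t := by exact_mod_cast v0
  have v1' : (1 : ℝ) ≤ visits α 1 t := by exact_mod_cast v1
  have hf := h.follows t ht 0
  rw [hα, armIndex_zero (by omega), armIndex_one (by omega)] at hf
  rw [max_eq_right ht1] at h2
  have h3 : I (empMean α r 1 t) (empMean α r 0 t) (visits α 1 t) t ≤
      I (empMean α r 1 t) (empMean α r 0 t) ((1 + ε) * inverseVisits I μ₁ μ₂ L t) t :=
    hI.mono _ (empMean_mem _ _ _ _) _ (empMean_mem _ _ _ _) _ (empMean_mem _ _ _ _) _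
      (empMean_mem _ _ _ _) _ _ _ _ v1' (by nlinarith [hn.1]) ht1 ht1 le_rfl le_rfl hgt.le le_rfl
  have h4 : I (empMean α r 0 t) (empMean α r 1 t) t t ≤
      I (empMean α r 0 t) (empMean α r 1 t) (visits α 0 t) t :=
    hI.mono _ (empMean_mem _ _ _ _) _ (empMean_mem _ _ _ _) _ (empMean_mem _ _ _ _) _
      (empMean_mem _ _ _ _) _ _ _ _ ht1 v0' ht1 ht1 le_rfl le_rfl
      (by exact_mod_cast visits_le α 0 t) le_rfl
  exact absurd (h2.trans_le (h4.trans (hf.trans (h3.trans h1.2)))) (lt_irrefl _)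

/-- The count only grows when arm 2 is played, and then it was bounded; between plays `n₂` is
nondecreasing. The extra `1` and the initial count are absorbed because `n₂` tends to infinity. -/
theorem IsTypical.visits_le_eventually (hI : IsRegularIndex I Imax μ₁ μ₂ L ρ) (hμ₂ : 0 < μ₂)
    (hμ : μ₂ < μ₁) (hμ₁ : μ₁ < 1) (h : IsTypical I μ₁ μ₂ α r) {ε : ℝ} (hε : 0 < ε)
    (hε1 : ε < 1) :
    ∀ᶠ t : ℕ in atTop, (visits α 1 t : ℝ) ≤ (1 + ε) * inverseVisits I μ₁ μ₂ L t := by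
  obtain ⟨T₀, hT₀, hmono⟩ := inverseVisits_mono hI hμ₂ hμ hμ₁
  obtain ⟨T₁, hT₁⟩ := eventually_atTop.1 ((h.visits_le_of_play hI hμ₂ hμ hμ₁ (half_pos hε)
    (by linarith)).and (tendsto_natCast_atTop_atTop.eventually_ge_atTop T₀))
  have hT1 : ∀ t : ℕ, T₁ ≤ t → 1 ≤ t := fun t ht => by
    exact_mod_cast hT₀.trans (hT₁ t ht).2
  have key : ∀ t : ℕ, T₁ ≤ t → (visits α 1 t : ℝ) ≤
      max (visits α 1 T₁ : ℝ) ((1 + ε / 2) * inverseVisits I μ₁ μ₂ L t + 1) := by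
    intro t ht
    induction t, ht using Nat.le_induction with
    | base => exact le_max_left _ _
    | succ t ht ih =>
      have hm : inverseVisits I μ₁ μ₂ L t ≤ inverseVisits I μ₁ μ₂ L (t + 1 : ℕ) :=
        hmono _ _ (hT₁ t ht).2 (by push_cast; linarith)
      have hm' : (1 + ε / 2) * inverseVisits I μ₁ μ₂ L t ≤
        (1 + ε / 2) * inverseVisits I μ₁ μ₂ L (t + 1 : ℕ) :=
        mul_le_mul_of_nonneg_left hm (by linarith)
      rw [visits_succ α 1 (hT1 t ht)]
      split_ifs with hα
      · refine le_max_of_le_right ?_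
        have := (hT₁ t ht).1 hα
        push_cast at *
        linarith
      · refine ih.trans (max_le_max le_rfl ?_)
        linarith
  have hn₂ : Tendsto (fun t : ℕ => inverseVisits I μ₁ μ₂ L t) atTop atTop :=
    hI.tendsto_visits.comp tendsto_natCast_atTop_atTop
  filter_upwards [eventually_ge_atTop T₁, hn₂.eventually_ge_atTop (visits α 1 T₁ : ℝ),
    hn₂.eventually_ge_atTop (2 / ε)] with t ht h1 h2
  refine (key t ht).trans (max_le ?_ ?_)
  · have : (0 : ℝ) ≤ visits α 1 T₁ := by positivity
    nlinarith
  · rw [div_le_iff₀ hε] at h2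
    nlinarith

theorem IsTypical.visits_zero_equivalent (hI : IsRegularIndex I Imax μ₁ μ₂ L ρ) (hμ₂ : 0 < μ₂)
    (hμ : μ₂ < μ₁) (hμ₁ : μ₁ < 1) (h : IsTypical I μ₁ μ₂ α r) :
    (fun t => (visits α 0 t : ℝ)) ~[atTop] fun t => (t : ℝ) := by
  have ho : (fun t : ℕ => inverseVisits I μ₁ μ₂ L t) =o[atTop] fun t : ℕ => (t : ℝ) :=
    hI.sublinear.comp_tendsto tendsto_natCast_atTop_atTop
  have h1 : (fun t : ℕ => (visits α 1 t : ℝ)) =O[atTop] fun t : ℕ => inverseVisits I μ₁ μ₂ L t := by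
    refine IsBigO.of_bound (1 + 1 / 2) ?_
    filter_upwards [h.visits_le_eventually hI hμ₂ hμ hμ₁ (ε := 1 / 2) (by norm_num) (by norm_num)]
      with t ht
    rw [Real.norm_of_nonneg (by positivity)]
    exact ht.trans (mul_le_mul_of_nonneg_left (le_abs_self _) (by norm_num))
  have h2 : (fun _ : ℕ => (1 : ℝ)) =o[atTop] fun t : ℕ => (t : ℝ) :=
    isLittleO_const_left.2 (Or.inr (tendsto_norm_atTop_atTop.comp tendsto_natCast_atTop_atTop))
  refine isEquivalent_natCast_of_sub (((h1.trans_isLittleO ho).add h2).neg_left.congr' ?_ .rfl)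
  filter_upwards [eventually_ge_atTop 1] with t ht
  have h3 : (visits α 0 t : ℝ) + visits α 1 t + 1 = t := by
    exact_mod_cast visits_add_visits α 0 ht
  linarith

theorem IsTypical.play_of_visits_lt (hI : IsRegularIndex I Imax μ₁ μ₂ L ρ) (hμ₂ : 0 < μ₂)
    (hμ : μ₂ < μ₁) (hμ₁ : μ₁ < 1) (h : IsTypical I μ₁ μ₂ α r) {ε : ℝ} (hε : 0 < ε)
    (hε1 : ε < 1) :
    ∀ᶠ t : ℕ in atTop, (visits α 1 t : ℝ) < (1 - ε) * inverseVisits I μ₁ μ₂ L t → α t = 1 := by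
  have hμ1pos : 0 < μ₁ := hμ₂.trans hμ
  have m0 := h.tendsto_mean hI hμ₂ hμ hμ₁ 0
  have m1 := h.tendsto_mean hI hμ₂ hμ hμ₁ 1
  obtain ⟨η, hη, hev⟩ := index_away hI hμ₂ hμ hμ₁ (empMean_mem α r 0) (empMean_mem α r 1) m0 m1
    hε hε1
  have hlim := hI.converges (empMean α r 0) (empMean α r 1)
    (fun t : ℕ => max 1 (visits α 0 t : ℝ))
    (empMean_mem α r 0) (empMean_mem α r 1) (fun t => le_max_left _ _)
    ((isEquivalent_const_iff_tendsto hμ1pos.ne').2 m0)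
    ((isEquivalent_const_iff_tendsto hμ₂.ne').2 m1)
    ((h.visits_zero_equivalent hI hμ₂ hμ hμ₁).congr_left
      (((h.tendsto_visits hI hμ₂ hμ hμ₁ 0).eventually_ge_atTop 1).mono fun t ht =>
        (max_eq_right (show (1 : ℝ) ≤ visits α 0 t by exact_mod_cast ht)).symm))
  have hlt : ENNReal.ofReal L < ENNReal.ofReal ((1 + η) * L) :=
    (ENNReal.ofReal_lt_ofReal_iff (by have := hI.limit_pos; positivity)).2
      (by nlinarith [hI.limit_pos])
  filter_upwards [hev, hlim.eventually_lt_const hlt, eventually_ge_atTop 1,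
    (h.tendsto_visits hI hμ₂ hμ hμ₁ 0).eventually_ge_atTop 1,
    (h.tendsto_visits hI hμ₂ hμ hμ₁ 1).eventually_ge_atTop 1]
    with t h1 h2 ht v0 v1 hN
  have ht1 : (1 : ℝ) ≤ t := by exact_mod_cast ht
  have v0' : (1 : ℝ) ≤ visits α 0 t := by exact_mod_cast v0
  have v1' : (1 : ℝ) ≤ visits α 1 t := by exact_mod_cast v1
  rw [max_eq_right v0'] at h2
  rcases fin_two_eq_or 1 (α t) with hα | hα
  · exact hα
  have hα : α t = 0 := hα
  have hf := h.follows t ht 1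
  rw [hα, armIndex_zero (by omega), armIndex_one (by omega)] at hf
  have h3 : I (empMean α r 1 t) (empMean α r 0 t) ((1 - ε) * inverseVisits I μ₁ μ₂ L t) t ≤
      I (empMean α r 1 t) (empMean α r 0 t) (visits α 1 t) t :=
    hI.mono _ (empMean_mem _ _ _ _) _ (empMean_mem _ _ _ _) _ (empMean_mem _ _ _ _) _
      (empMean_mem _ _ _ _) _ _ _ _ (v1'.trans hN.le) v1' ht1 ht1 le_rfl le_rfl hN.le le_rfl
  exact absurd (h2.trans_le (h1.1.trans (h3.trans hf))) (lt_irrefl _)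

theorem exists_last_play (a : Fin 2) {s₀ t : ℕ} (hs : α s₀ = a) (hst : s₀ < t) :
    ∃ s, s₀ ≤ s ∧ s < t ∧ α s = a ∧ ∀ i, s < i → i < t → α i ≠ a := by
  classical
  refine ⟨Nat.findGreatest (fun m => α m = a) (t - 1), Nat.le_findGreatest (by omega) hs, ?_,
    Nat.findGreatest_spec (P := fun m => α m = a) (m := s₀) (by omega) hs, fun i hi hit => ?_⟩
  · have := Nat.findGreatest_le (P := fun m => α m = a) (t - 1)
    omega
  · exact Nat.findGreatest_is_greatest hi (by omega)

/-- At the last play `s < t` of arm 1, arm 2 was not forced, so its visits were at least `(1 - ε /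
2) n₂ s`. From `s + 1` on only arm 2 was played, and it has `o(t)` visits, so `s ≥ t / 2`; slow
variation identifies `n₂ (t / 2)` with `n₂ t` asymptotically. -/
theorem IsTypical.le_visits_eventually (hI : IsRegularIndex I Imax μ₁ μ₂ L ρ) (hμ₂ : 0 < μ₂)
    (hμ : μ₂ < μ₁) (hμ₁ : μ₁ < 1) (h : IsTypical I μ₁ μ₂ α r) {ε : ℝ} (hε : 0 < ε)
    (hε1 : ε < 1) :
    ∀ᶠ t : ℕ in atTop, (1 - ε) * inverseVisits I μ₁ μ₂ L t ≤ (visits α 1 t : ℝ) := by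
  obtain ⟨T₀, hT₀, hmono⟩ := inverseVisits_mono hI hμ₂ hμ hμ₁
  obtain ⟨T₁, hT₁⟩ := eventually_atTop.1 (h.play_of_visits_lt hI hμ₂ hμ hμ₁ (half_pos hε)
    (by linarith))
  obtain ⟨s₀, hs₀, hs₀T⟩ := (h.infinite_plays hI hμ₂ hμ hμ₁ 0).exists_gt T₁
  have ho : (fun t : ℕ => inverseVisits I μ₁ μ₂ L t) =o[atTop] fun t : ℕ => (t : ℝ) :=
    hI.sublinear.comp_tendsto tendsto_natCast_atTop_atTop
  have hslow : (fun t : ℕ => inverseVisits I μ₁ μ₂ L t) ~[atTop]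
      fun t : ℕ => inverseVisits I μ₁ μ₂ L (1 / 2 * (t : ℝ)) :=
    (hI.slow_visits (1 / 2) (by norm_num)).comp_tendsto tendsto_natCast_atTop_atTop
  have hhalf : Tendsto (fun t : ℕ => 1 / 2 * (t : ℝ)) atTop atTop :=
    tendsto_natCast_atTop_atTop.const_mul_atTop (by norm_num)
  -- Visits at most `(3 / 2) (t / 6) = t / 4`, together with `1 ≤ t / 4`, give `s ≥ t / 2`.
  filter_upwards [eventually_gt_atTop s₀,
    h.visits_le_eventually hI hμ₂ hμ hμ₁ (ε := 1 / 2) (by norm_num) (by norm_num),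
    ho.def (c := 1 / 6) (by norm_num), hslow.eventually_abs_sub_le (half_pos hε),
    hhalf.eventually_ge_atTop T₀, eventually_ge_atTop 4,
    hhalf.eventually (inverseVisits_const_spec hI hμ₂ (hμ₂.trans hμ))]
    with t hts hup hsm hsl hT ht4 hpos
  obtain ⟨s, hs, hst, hα, hlast⟩ := exists_last_play 0 hs₀.2 hts
  have hs1 : 1 ≤ s := hs₀.1.trans hs
  have hrun : ∀ i < t - (s + 1), α (s + 1 + i) = 1 := fun i hi => by
    rcases fin_two_eq_or 0 (α (s + 1 + i)) with h0 | h0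
    · exact absurd h0 (hlast _ (by omega) (by omega))
    · exact h0
  have hv := visits_eq_of_forall (a := 1) (by omega) (t - (s + 1)) hrun
  rw [Nat.add_sub_cancel' (by omega : s + 1 ≤ t), visits_succ α 1 hs1, if_neg (by rw [hα]; decide),
    add_zero] at hv
  have hv' : (visits α 1 t : ℝ) + s + 1 = visits α 1 s + t := by
    have : visits α 1 t + s + 1 = visits α 1 s + t := by omega
    exact_mod_cast this
  have ht4' : (4 : ℝ) ≤ t := by exact_mod_cast ht4
  rw [Real.norm_of_nonneg (by positivity : (0 : ℝ) ≤ t)] at hsm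
  have hsm' := (le_abs_self _).trans hsm
  have hvs0 : (0 : ℝ) ≤ visits α 1 s := by positivity
  have hts2 : 1 / 2 * (t : ℝ) ≤ s := by linarith
  have hlow : (1 - ε / 2) * inverseVisits I μ₁ μ₂ L s ≤ visits α 1 s := by
    by_contra! hlt
    have := hT₁ s (by omega) hlt
    rw [hα] at this
    exact absurd this (by decide)
  have hm := hmono _ _ hT hts2
  have hvm : (visits α 1 s : ℝ) ≤ visits α 1 t := by exact_mod_cast visits_mono α 1 hst.le
  rw [abs_of_pos (a := inverseVisits I μ₁ μ₂ L (1 / 2 * (t : ℝ))) (by linarith [hpos.1])] at hsl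
  have h5 := (abs_le.1 hsl).2
  have h6 : (1 - ε / 2) * inverseVisits I μ₁ μ₂ L (1 / 2 * (t : ℝ)) ≤
      (1 - ε / 2) * inverseVisits I μ₁ μ₂ L s := mul_le_mul_of_nonneg_left hm (by linarith)
  have h7 : (1 - ε) * inverseVisits I μ₁ μ₂ L t ≤
      (1 - ε) * ((1 + ε / 2) * inverseVisits I μ₁ μ₂ L (1 / 2 * (t : ℝ))) :=
    mul_le_mul_of_nonneg_left (by linarith) (by linarith)
  have h8 : 0 ≤ ε * (ε * inverseVisits I μ₁ μ₂ L (1 / 2 * (t : ℝ))) :=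
    mul_nonneg hε.le (mul_nonneg hε.le (by linarith [hpos.1]))
  linarith

theorem IsTypical.visits_one_equivalent (hI : IsRegularIndex I Imax μ₁ μ₂ L ρ) (hμ₂ : 0 < μ₂)
    (hμ : μ₂ < μ₁) (hμ₁ : μ₁ < 1) (h : IsTypical I μ₁ μ₂ α r) :
    (fun t => (visits α 1 t : ℝ)) ~[atTop] fun t : ℕ => inverseVisits I μ₁ μ₂ L t := by
  refine isLittleO_iff.2 fun c hc => ?_
  have hc' : 0 < min c (1 / 2) := lt_min hc (by norm_num)
  have hc1 : min c (1 / 2) < 1 := lt_of_le_of_lt (min_le_right _ _) (by norm_num)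
  filter_upwards [h.visits_le_eventually hI hμ₂ hμ hμ₁ hc' hc1,
    h.le_visits_eventually hI hμ₂ hμ hμ₁ hc' hc1,
    tendsto_natCast_atTop_atTop.eventually (inverseVisits_const_spec hI hμ₂ (hμ₂.trans hμ))]
    with t h1 h2 h3
  have h0 := h3.1
  have hle : min c (1 / 2) * inverseVisits I μ₁ μ₂ L t ≤ c * inverseVisits I μ₁ μ₂ L t :=
    mul_le_mul_of_nonneg_right (min_le_left _ _) (by linarith)
  rw [Pi.sub_apply, Real.norm_eq_abs, Real.norm_of_nonneg (by linarith), abs_le]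
  constructor <;> linarith

theorem IsTypical.inRegime (hI : IsRegularIndex I Imax μ₁ μ₂ L ρ) (hμ₂ : 0 < μ₂)
    (hμ : μ₂ < μ₁) (hμ₁ : μ₁ < 1) (h : IsTypical I μ₁ μ₂ α r) :
    InRegime μ₁ μ₂ (inverseVisits I μ₁ μ₂ L) (empMean α r) (fun a t => (visits α a t : ℝ)) where
  mean_one := (isEquivalent_const_iff_tendsto (hμ₂.trans hμ).ne').2
    (h.tendsto_mean hI hμ₂ hμ hμ₁ 0)
  mean_two := (isEquivalent_const_iff_tendsto hμ₂.ne').2 (h.tendsto_mean hI hμ₂ hμ hμ₁ 1)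
  visits_one := h.visits_zero_equivalent hI hμ₂ hμ hμ₁
  visits_two := h.visits_one_equivalent hI hμ₂ hμ hμ₁

end Regime

/-! ## Variations of the indexes during an exploration -/

theorem HasDerivAt.nonneg_of_eventually_le_left {f : ℝ → ℝ} {f' x : ℝ} (hf : HasDerivAt f f' x)
    (h : ∀ᶠ z in 𝓝[<] x, f z ≤ f x) : 0 ≤ f' := by
  have h1 := (hasDerivWithinAt_iff_tendsto_slope' (s := Set.Iio x) (by simp)).1 hf.hasDerivWithinAt
  refine ge_of_tendsto h1 ?_
  filter_upwards [h, self_mem_nhdsWithin] with z hz hzx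
  rw [slope_def_field]
  exact div_nonneg_of_nonpos (by linarith) (by have := Set.mem_Iio.1 hzx; linarith)

/-- Neighborhoods for coordinatewise equivalence are stable under splicing along any set of times;
this is what allows the regime assumptions to be tested on artificial sequences. -/
theorem isEquivalent_ite {u v w : ℕ → ℝ} (E : ℕ → Prop) [DecidablePred E] (hu : u ~[atTop] w)
    (hv : v ~[atTop] w) : (fun t => if E t then u t else v t) ~[atTop] w := by
  refine isLittleO_iff.2 fun c hc => ?_
  filter_upwards [hu.isLittleO.def hc, hv.isLittleO.def hc] with t h1 h2
  simp only [Pi.sub_apply] at h1 h2 ⊢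
  split_ifs
  · exact h1
  · exact h2

/-! ### The own-mean derivative of the index of arm 2 does not vanish -/

section Derivatives

variable {I : ℝ → ℝ → ℝ → ℝ → ℝ≥0∞} {Imax : ℝ≥0∞} {μ₁ μ₂ L ρ : ℝ}

theorem dOwn_nonneg (hI : IsRegularIndex I Imax μ₁ μ₂ L ρ) {x y n t : ℝ}
    (hx : x ∈ Set.Ioo (0 : ℝ) 1) (hy : y ∈ Set.Icc (0 : ℝ) 1) (hn : 1 ≤ n) (ht : 1 ≤ t)
    (h : HasPartials I x y n t) : 0 ≤ dOwn I x y n t := by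
  refine h.2.1.hasDerivAt.nonneg_of_eventually_le_left ?_
  filter_upwards [Ioo_mem_nhdsLT hx.1] with z hz
  exact ENNReal.toReal_mono h.1 (hI.mono z ⟨hz.1.le, (hz.2.trans hx.2).le⟩ x ⟨hx.1.le, hx.2.le⟩ _ hy
    _ hy _ _ _ _ hn hn ht ht hz.2.le le_rfl le_rfl le_rfl)

/-- If the own-mean derivative vanishes at `t`, so do the visits derivative, by optimism, and the
time derivative, by negligibility. Apply the Taylor expansion to a spliced sequence that keeps both
means between `t` and `t + 1` but moves the visits to the inverse at level `L` plus `c`: all four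
terms vanish, hence so does the increment of the index. -/
theorem index_eq_of_dOwn_eq_zero (hI : IsRegularIndex I Imax μ₁ μ₂ L ρ) (hμ₂ : 0 < μ₂)
    (hμ : μ₂ < μ₁) {ν m : Fin 2 → ℕ → ℝ}
    (hreg : InRegime μ₁ μ₂ (inverseVisits I μ₁ μ₂ L) ν m)
    (E : ℕ → Prop) (hE : ∀ t, E t → ¬E (t + 1)) (c : ℝ) :
    ∀ᶠ t : ℕ in atTop, E t → dOwn I (ν 1 t) (ν 0 t) (m 1 t) t = 0 →
      (I (ν 1 t) (ν 0 t) (inverseVisits I (ν 0 t) (ν 1 t) L (t + 1 : ℕ) + c) (t + 1 : ℕ)).toReal =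
        (I (ν 1 t) (ν 0 t) (m 1 t) t).toReal := by
  classical
  have hμ1pos : 0 < μ₁ := hμ₂.trans hμ
  have hL := hI.limit_pos
  have n0 : Tendsto (fun t => ν 0 (t - 1)) atTop (𝓝 μ₁) :=
    ((isEquivalent_const_iff_tendsto hμ1pos.ne').1 hreg.mean_one).comp (tendsto_sub_atTop_nat 1)
  have n1 : Tendsto (fun t => ν 1 (t - 1)) atTop (𝓝 μ₂) :=
    ((isEquivalent_const_iff_tendsto hμ₂.ne').1 hreg.mean_two).comp (tendsto_sub_atTop_nat 1)
  have e0 := (isEquivalent_const_iff_tendsto hμ1pos.ne').2 n0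
  have e1 := (isEquivalent_const_iff_tendsto hμ₂.ne').2 n1
  set g : ℕ → ℝ := fun t => inverseVisits I (ν 0 (t - 1)) (ν 1 (t - 1)) L t with hg
  have hn₂ : Tendsto (fun t : ℕ => inverseVisits I μ₁ μ₂ L t) atTop atTop :=
    hI.tendsto_visits.comp tendsto_natCast_atTop_atTop
  have hge : (fun t => g t + c) ~[atTop] fun t : ℕ => inverseVisits I μ₁ μ₂ L t := by
    obtain ⟨ε, hε, -, heq⟩ := hI.inverse
    have hL' : |L - L| < ε * L := by simpa using mul_pos hε hL
    have h1 : g ~[atTop] fun t : ℕ => inverseVisits I μ₁ μ₂ L t :=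
      heq (fun _ => μ₁) (fun _ => μ₂) (fun _ => L) (fun t => ν 0 (t - 1)) (fun t => ν 1 (t - 1))
        (fun _ => L)
        (Eventually.of_forall fun _ => ⟨by simpa using mul_pos hε hμ1pos,
          by simpa using mul_pos hε hμ₂, hL'⟩)
        (by filter_upwards [eventually_abs_sub_lt_of_tendsto n0 (mul_pos hε hμ1pos),
              eventually_abs_sub_lt_of_tendsto n1 (mul_pos hε hμ₂)] with t a b using ⟨a, b, hL'⟩)
        e0 e1 IsEquivalent.refl
    exact h1.add_isLittleO (isLittleO_const_left.2 (Or.inr (tendsto_norm_atTop_atTop.comp hn₂)))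
  -- Since `E` contains no two consecutive times, time `t + 1` is free to carry the means of time
  -- `t` whenever `E t` holds.
  set ν' : Fin 2 → ℕ → ℝ := fun a t => if E t then ν a t else ν a (t - 1) with hν'
  set m' : Fin 2 → ℕ → ℝ := ![m 0, fun t => if E t then m 1 t else g t + c] with hm'
  have hreg' : InRegime μ₁ μ₂ (inverseVisits I μ₁ μ₂ L) ν' m' :=
    ⟨isEquivalent_ite E hreg.mean_one e0, isEquivalent_ite E hreg.mean_two e1,
      hreg.visits_one, isEquivalent_ite E hreg.visits_two hge⟩
  have h1 := (hI.taylor ν' m' hreg' 1 1 le_rfl).def (c := 1) one_pos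
  have h2 := (hI.optimism ν' m' hreg').eventually_abs_sub_le (ε := 1) one_pos
  have h3 := (hI.negligible_time_two ν' m' hreg').def (c := 1) one_pos
  filter_upwards [h1, h2, h3] with t h1 h2 h3 hEt hD
  have a1 : ∀ a, ν' a t = ν a t := fun a => if_pos hEt
  have a2 : ∀ a, ν' a (t + 1) = ν a t := fun a => by
    rw [hν']; simp only [if_neg (hE t hEt), Nat.add_sub_cancel]
  have a3 : m' 1 t = m 1 t := if_pos hEt
  have a4 : m' 1 (t + 1) = g (t + 1) + c := if_neg (hE t hEt)
  simp only [a1, a3, hD] at h2 h3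
  have hV : dVisits I (ν 1 t) (ν 0 t) (m 1 t) t = 0 := by simpa using h2
  rw [hV] at h3
  have hT : dTime I (ν 1 t) (ν 0 t) (m 1 t) t = 0 := by simpa using h3
  have h10 : (1 - 1 : Fin 2) = 0 := rfl
  simp only [h10, a1, a2, a3, a4, hD, hV, hT, sub_self, zero_mul, mul_zero, add_zero, sub_zero,
    abs_zero, norm_zero] at h1
  have := norm_le_zero_iff.1 h1
  have hgt : g (t + 1) = inverseVisits I (ν 0 t) (ν 1 t) L (t + 1 : ℕ) := by
    simp only [hg, Nat.add_sub_cancel]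
  rw [hgt] at this
  linarith

/-- Taking `c = 0` and `c = 1` would give the index the same value `L` at two visit counts differing
by one, against uniqueness of the inverse. Even and odd times are treated separately so that no two
test times are consecutive. This strictness lets the first-order term decide the order of the
indexes. -/
theorem dOwn_ne_zero (hI : IsRegularIndex I Imax μ₁ μ₂ L ρ) (hμ₂ : 0 < μ₂) (hμ : μ₂ < μ₁)
    {ν m : Fin 2 → ℕ → ℝ} (hreg : InRegime μ₁ μ₂ (inverseVisits I μ₁ μ₂ L) ν m) :
    ∀ᶠ t : ℕ in atTop, dOwn I (ν 1 t) (ν 0 t) (m 1 t) t ≠ 0 := by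
  have hμ1pos : 0 < μ₁ := hμ₂.trans hμ
  have hL := hI.limit_pos
  have n0 : Tendsto (ν 0) atTop (𝓝 μ₁) :=
    (isEquivalent_const_iff_tendsto hμ1pos.ne').1 hreg.mean_one
  have n1 : Tendsto (ν 1) atTop (𝓝 μ₂) :=
    (isEquivalent_const_iff_tendsto hμ₂.ne').1 hreg.mean_two
  obtain ⟨ε, hε, hinv, -⟩ := hI.inverse
  have hinvN := (tendsto_natCast_atTop_atTop.comp (tendsto_add_atTop_nat 1)).eventually hinv
  have key : ∀ E : ℕ → Prop, (∀ t, E t → ¬E (t + 1)) →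
      ∀ᶠ t : ℕ in atTop, E t → dOwn I (ν 1 t) (ν 0 t) (m 1 t) t ≠ 0 := by
    intro E hE
    filter_upwards [index_eq_of_dOwn_eq_zero hI hμ₂ hμ hreg E hE 0,
      index_eq_of_dOwn_eq_zero hI hμ₂ hμ hreg E hE 1, hinvN,
      eventually_abs_sub_lt_of_tendsto n0 (mul_pos hε hμ1pos),
      eventually_abs_sub_lt_of_tendsto n1 (mul_pos hε hμ₂)] with t h0 h1 hi c0 c1 hEt hD
    have h2 := (h1 hEt hD).trans (h0 hEt hD).symm
    obtain ⟨g1, g2, g3⟩ := inverseVisits_spec (hi _ _ L c0 c1 (by simpa using mul_pos hε hL))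
    simp only [Function.comp] at g1 g2 g3
    rw [add_zero, g2, ENNReal.toReal_ofReal hL.le] at h2
    have hne : I (ν 1 t) (ν 0 t) (inverseVisits I (ν 0 t) (ν 1 t) L (t + 1 : ℕ) + 1) (t + 1 : ℕ) ≠
        ⊤ := by
      intro htop
      rw [htop, ENNReal.toReal_top] at h2
      exact hL.ne h2
    have h3 := g3 (inverseVisits I (ν 0 t) (ν 1 t) L (t + 1 : ℕ) + 1) (by linarith)
      ((ENNReal.ofReal_toReal hne).symm.trans (congrArg _ h2))
    linarith
  filter_upwards [key Even fun t h => Nat.not_even_iff_odd.2 h.add_one,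
    key (fun t => ¬Even t) fun t h => not_not.2 (Nat.not_even_iff_odd.1 h).add_one] with t h1 h2
  by_cases hE : Even t
  · exact h1 hE
  · exact h2 hE

end Derivatives

/-! ### Why good rewards keep arm 2 in play -/

section Stay

variable {I : ℝ → ℝ → ℝ → ℝ → ℝ≥0∞} {Imax : ℝ≥0∞} {μ₁ μ₂ L ρ : ℝ} {α : ℕ → Fin 2} {r : ℕ → Bool}

/-- The numerical value of a reward. -/
noncomputable def rewardValue (b : Bool) : ℝ := if b = true then 1 else 0

theorem rewardValue_mem (b : Bool) : rewardValue b ∈ Set.Icc (0 : ℝ) 1 := by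
  unfold rewardValue; split_ifs <;> simp

/-- Variation of an empirical mean `V` over `N` observations after `h` more with sum `K`. -/
theorem mean_variation {h N V V' K μ₂ ε : ℝ} (hh : 0 < h) (hN : 0 < N) (hK0 : 0 ≤ K) (hKh : K ≤ h)
    (hV0 : 0 ≤ V) (hV1 : V ≤ 1) (hVμ : |V - μ₂| < ε) (hhN : h ≤ ε * N)
    (hV' : V' = (V * N + K) / (N + h)) :
    |(V' - V) * N| ≤ h ∧ K - h * μ₂ - 2 * (h * ε) ≤ (V' - V) * N := by
  have s1 : (V' - V) * N = (K - h * V) * (N / (N + h)) := by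
    have : N + h ≠ 0 := by positivity
    rw [hV']; field_simp; ring
  have hfr0 : 0 ≤ N / (N + h) := by positivity
  have hfr1 : N / (N + h) ≤ 1 := by rw [div_le_one (by positivity)]; linarith
  have hfr2 : 1 - N / (N + h) ≤ ε := by
    have hε : 0 < ε := (abs_nonneg _).trans_lt hVμ
    have e : 1 - N / (N + h) = h / (N + h) := by field_simp; ring
    rw [e, div_le_iff₀ (by positivity)]
    have := mul_pos hε hh
    linarith
  have hKV : |K - h * V| ≤ h := by
    have h1 := mul_nonneg hh.le hV0
    have h2 := mul_le_mul_of_nonneg_left hV1 hh.le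
    rw [abs_le]
    constructor <;> linarith
  rw [s1]
  constructor
  · rw [abs_mul, abs_of_nonneg hfr0]
    calc |K - h * V| * (N / (N + h)) ≤ h * 1 := by gcongr
      _ = h := mul_one _
  · have e1 : |(K - h * V) * (1 - N / (N + h))| ≤ h * ε := by
      rw [abs_mul, abs_of_nonneg (by linarith : 0 ≤ 1 - N / (N + h))]
      gcongr
    have e2 : h * (V - μ₂) ≤ h * ε := mul_le_mul_of_nonneg_left (abs_lt.1 hVμ).2.le hh.le
    have e3 := (abs_le.1 e1).2
    have e4 : (K - h * V) * (N / (N + h)) = K - h * V - (K - h * V) * (1 - N / (N + h)) := by ring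
    rw [e4]; linarith

/-- The first-order variations of the indexes preserve their order when the average reward `K / h`
exceeds the optimism threshold `μ₂ + κ`. -/
theorem index_lt_of_expansions {h N V V' K μ₂ κ ε δ D dV d1 d2 dO I1 I1' I2 I2' : ℝ} (hh : 0 < h)
    (hN : 0 < N) (hD : 0 < D) (hκ0 : 0 ≤ κ) (hκ1 : κ ≤ 1) (hε : 0 < ε) (hε1 : ε ≤ 1)
    (hεδ : 17 * ε ≤ δ) (hgap : δ ≤ -κ + (K / h - μ₂))
    (hs_abs : |(V' - V) * N| ≤ h) (hs_low : K - h * μ₂ - 2 * (h * ε) ≤ (V' - V) * N)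
    (opt : |dV - -(κ / N) * D| ≤ ε * |-(κ / N) * D|) (neg1 : |d1| ≤ ε * |dV|)
    (neg2 : |d2| ≤ ε * |dV|) (negm : |dO| ≤ ε * |D|)
    (tay2 : |I2' - I2 - ((V' - V) * D + h * dV + h * d2)| ≤
      ε * |(|(V' - V) * D| + |h * dV| + |h * d2|)|)
    (tay1 : |I1' - I1 - ((V' - V) * dO + h * d1)| ≤ 1 * |(|(V' - V) * dO| + |h * d1|)|)
    (hstart : I1 ≤ I2) : I1' < I2' := by
  -- `W` is the natural unit: the mean moves by `O(h / N)` and the visits derivative is of order at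
  -- most `D / N`, so every term is compared with `w = h * W`.
  obtain ⟨W, hW⟩ : ∃ W, W = D / N := ⟨_, rfl⟩
  have hWpos : 0 < W := hW ▸ div_pos hD hN
  have hDW : D = W * N := by rw [hW, div_mul_cancel₀ _ hN.ne']
  have hκW0 : 0 ≤ κ * W := mul_nonneg hκ0 hWpos.le
  have hκW : κ * W ≤ W := (mul_le_mul_of_nonneg_right hκ1 hWpos.le).trans (one_mul W).le
  have hopt : |dV + κ * W| ≤ ε * W := by
    have e : -(κ / N) * D = -(κ * W) := by
      rw [hDW]; field_simp
    rw [e, abs_neg, abs_of_nonneg hκW0, sub_neg_eq_add] at opt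
    exact opt.trans (mul_le_mul_of_nonneg_left hκW hε.le)
  have hεW1 : ε * W ≤ W := (mul_le_mul_of_nonneg_right hε1 hWpos.le).trans (one_mul W).le
  have hdV2 : |dV| ≤ 2 * W := by
    rw [abs_le] at hopt ⊢
    constructor <;> linarith
  have hεdV : ε * |dV| ≤ 2 * (ε * W) := by
    have := mul_le_mul_of_nonneg_left hdV2 hε.le
    linarith
  have hd1W : |d1| ≤ 2 * (ε * W) := neg1.trans hεdV
  have hd2W : |d2| ≤ 2 * (ε * W) := neg2.trans hεdV
  rw [abs_of_pos hD] at negm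
  obtain ⟨S, hS⟩ : ∃ S, S = (V' - V) * N := ⟨_, rfl⟩
  have hT1 : (V' - V) * D = S * W := by rw [hDW, hS]; ring
  rw [hT1] at tay2
  rw [← hS] at hs_abs hs_low
  obtain ⟨w, hw⟩ : ∃ w, w = h * W := ⟨_, rfl⟩
  have hwpos : 0 < w := hw ▸ mul_pos hh hWpos
  have hεw : 0 < ε * w := mul_pos hε hwpos
  have hεw' : h * (ε * W) = ε * w := by rw [hw]; ring
  have hεε : ε * (ε * w) ≤ ε * w := (mul_le_mul_of_nonneg_right hε1 hεw.le).trans (one_mul _).le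
  have b1 : |S * W| ≤ w := by
    rw [abs_mul, abs_of_pos hWpos, hw]
    exact mul_le_mul_of_nonneg_right hs_abs hWpos.le
  have b3 : |h * dV| ≤ 2 * w := by
    rw [abs_mul, abs_of_pos hh, hw]
    have := mul_le_mul_of_nonneg_left hdV2 hh.le
    linarith
  have b4 : |h * d2| ≤ 2 * (ε * w) := by
    rw [abs_mul, abs_of_pos hh, ← hεw']
    have := mul_le_mul_of_nonneg_left hd2W hh.le
    linarith
  have b5 : |h * d1| ≤ 2 * (ε * w) := by
    rw [abs_mul, abs_of_pos hh, ← hεw']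
    have := mul_le_mul_of_nonneg_left hd1W hh.le
    linarith
  have b6 : |(V' - V) * dO| ≤ ε * w := by
    rw [abs_mul]
    have e1 : |V' - V| * |dO| ≤ |V' - V| * (ε * D) :=
      mul_le_mul_of_nonneg_left negm (abs_nonneg _)
    have e2 : |V' - V| * (ε * D) = ε * |S * W| := by
      rw [hDW, hS, abs_mul, abs_mul, abs_of_pos hN, abs_of_pos hWpos]; ring
    rw [e2] at e1
    exact e1.trans (mul_le_mul_of_nonneg_left b1 hε.le)
  have c1 : (K / h - μ₂) * w - 2 * (ε * w) ≤ S * W := by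
    have e1 := mul_le_mul_of_nonneg_right hs_low hWpos.le
    have e2 : (K / h - μ₂) * w - 2 * (ε * w) = (K - h * μ₂ - 2 * (h * ε)) * W := by
      rw [hw]; field_simp
    rw [e2]; exact e1
  have c3 : -κ * w - ε * w ≤ h * dV := by
    have e1 := mul_le_mul_of_nonneg_left (abs_le.1 hopt).1 hh.le
    have e2 : -κ * w - ε * w = h * (-(ε * W)) - h * (κ * W) := by
      rw [hw]; ring
    rw [e2]; linarith
  have tay2' : ε * |(|S * W| + |h * dV| + |h * d2|)| ≤ 5 * (ε * w) := by
    rw [abs_of_nonneg (by positivity)]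
    have := mul_le_mul_of_nonneg_left (add_le_add (add_le_add b1 b3) b4) hε.le
    linarith
  have hfin2 := (abs_le.1 (tay2.trans tay2')).1
  -- For arm 1 a Taylor error of the size of the terms is harmless, since these terms are already
  -- `O(ε w)`.
  have tay1' : 1 * |(|(V' - V) * dO| + |h * d1|)| ≤ 3 * (ε * w) := by
    rw [abs_of_nonneg (by positivity)]
    linarith
  have hfin1 := (abs_le.1 (tay1.trans tay1')).2
  have g4 := (abs_le.1 b4).1
  have g5 := (abs_le.1 b5).2
  have g6 := (abs_le.1 b6).2
  have hgapw : δ * w ≤ -κ * w + (K / h - μ₂) * w := by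
    have := mul_le_mul_of_nonneg_right hgap hwpos.le
    linarith
  -- Losses for arm 2: `2 + 1 + 2 + 5` (mean, optimism, time, Taylor); gains for arm 1: `1 + 2 + 3`.
  -- The total `16 ε w` is strictly below `17 ε w`.
  have hδw : 17 * (ε * w) ≤ δ * w := by
    have := mul_le_mul_of_nonneg_right hεδ hwpos.le
    linarith
  linarith

/-- While arm 2 is played, the mean and visits of arm 1 are frozen, so its index feels only time and
the mean of arm 2, both negligible. The order of the indexes at `t`, witnessed by the play of arm 2,
therefore persists strictly at `t + h`. -/
theorem IsTypical.eventually_play_of_gap (hI : IsRegularIndex I Imax μ₁ μ₂ L ρ) (hμ₂ : 0 < μ₂)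
    (hμ : μ₂ < μ₁) (hμ₁ : μ₁ < 1) (htyp : IsTypical I μ₁ μ₂ α r) {h : ℕ} (hh : 1 ≤ h) {δ : ℝ}
    (hδ : 0 < δ) :
    ∀ᶠ t : ℕ in atTop, (∀ i < h, α (t + i) = 1) →
      δ ≤ -(ρ * (1 - μ₂)) + ((∑ i ∈ Finset.range h, rewardValue (r (t + i))) / h - μ₂) →
      α (t + h) = 1 := by
  have hreg := htyp.inRegime hI hμ₂ hμ hμ₁
  obtain ⟨ε, hε, hε1, hεδ⟩ : ∃ ε : ℝ, 0 < ε ∧ ε ≤ 1 ∧ 17 * ε ≤ δ :=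
    ⟨min 1 (δ / 17), by positivity, min_le_left _ _, by
      have := min_le_right 1 (δ / 17); linarith⟩
  have hhpos : (0 : ℝ) < h := by exact_mod_cast hh
  have n1 : Tendsto (empMean α r 1) atTop (𝓝 μ₂) := htyp.tendsto_mean hI hμ₂ hμ hμ₁ 1
  have hNt : Tendsto (fun t => (visits α 1 t : ℝ)) atTop atTop :=
    tendsto_natCast_atTop_atTop.comp (htyp.tendsto_visits hI hμ₂ hμ hμ₁ 1)
  have part := fun a => hI.hasPartials _ _ hreg a
  -- Finiteness is also needed at `t + h`, in order to compare real values of the indexes there.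
  have part' := fun a => (tendsto_add_atTop_nat h).eventually (part a)
  filter_upwards [(hI.taylor _ _ hreg 1 h hh).def hε, (hI.taylor _ _ hreg 0 h hh).def one_pos,
    (hI.optimism _ _ hreg).eventually_abs_sub_le hε, (hI.negligible_time_one _ _ hreg).def hε,
    (hI.negligible_time_two _ _ hreg).def hε, (hI.negligible_mean _ _ hreg).def hε,
    dOwn_ne_zero hI hμ₂ hμ hreg, part 1, part' 0,
    eventually_abs_sub_lt_of_tendsto n1 hε, hNt.eventually_ge_atTop (h / ε),
    (htyp.tendsto_visits hI hμ₂ hμ hμ₁ 1).eventually_ge_atTop 1,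
    (htyp.tendsto_visits hI hμ₂ hμ hμ₁ 0).eventually_ge_atTop 1,
    eventually_ge_atTop 1, n1.eventually_const_lt hμ₂, n1.eventually_lt_const (hμ.trans hμ₁)]
    with t tay2 tay1 opt neg1 neg2 negm hD0 p1 q0 hv hN hN1 hN0 ht hvpos hvlt hplay hgap
  have ht1 : (1 : ℝ) ≤ t := by exact_mod_cast ht
  have hN1' : (1 : ℝ) ≤ visits α 1 t := by exact_mod_cast hN1
  have hNpos : (0 : ℝ) < visits α 1 t := by linarith
  have h10 : (1 - 1 : Fin 2) = 0 := rfl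
  have h01 : (1 - 0 : Fin 2) = 1 := rfl
  simp only [h10, h01] at tay1 tay2 p1 q0
  have hne0 : ∀ i < h, α (t + i) ≠ 0 := fun i hi => by rw [hplay i hi]; decide
  have s0 : empMean α r 0 (t + h) = empMean α r 0 t := empMean_eq_of_forall_ne ht h hne0
  have v0 : visits α 0 (t + h) = visits α 0 t := visits_eq_of_forall_ne ht h hne0
  have v1 : visits α 1 (t + h) = visits α 1 t + h := visits_eq_of_forall ht h hplay
  have hK0 : 0 ≤ ∑ i ∈ Finset.range h, rewardValue (r (t + i)) :=
    Finset.sum_nonneg fun i _ => (rewardValue_mem _).1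
  have hKh : ∑ i ∈ Finset.range h, rewardValue (r (t + i)) ≤ h := by
    refine (Finset.sum_le_sum fun i _ => (rewardValue_mem (r (t + i))).2).trans ?_
    simp
  have hVmem := empMean_mem α r 1 t
  have hDpos := lt_of_le_of_ne
    (dOwn_nonneg hI ⟨hvpos, hvlt⟩ (empMean_mem α r 0 t) hN1' ht1 p1) (Ne.symm hD0)
  have hV' : empMean α r 1 (t + h) = (empMean α r 1 t * visits α 1 t +
      ∑ i ∈ Finset.range h, rewardValue (r (t + i))) / (visits α 1 t + h) := by
    have e : empMean α r 1 t * visits α 1 t = successes α r 1 t := by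
      rw [empMean, div_mul_cancel₀ _ hNpos.ne']
    rw [e, empMean, v1, successes_eq_of_forall ht h hplay, Nat.cast_add]
    rfl
  obtain ⟨m1, m2⟩ := mean_variation hhpos hNpos hK0 hKh hVmem.1 hVmem.2 hv
    (by rwa [div_le_iff₀ hε, mul_comm] at hN) hV'
  have hκ0 : 0 ≤ ρ * (1 - μ₂) := mul_nonneg hI.rho_nonneg (by linarith)
  have hκ1 : ρ * (1 - μ₂) ≤ 1 :=
    mul_le_one₀ hI.rho_lt_one.le (by linarith) (by linarith)
  have sN : (visits α 1 t : ℝ) + h - visits α 1 t = h := by ring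
  simp only [Real.norm_eq_abs, s0, v0, v1, Nat.cast_add (visits α 1 t), sub_self, zero_mul,
    abs_zero, add_zero, zero_add, sN] at tay1 tay2 neg1 neg2 negm
  have hstart := htyp.follows t ht 0
  rw [show α t = 1 from hplay 0 (by omega), armIndex_zero (by omega),
    armIndex_one (by omega)] at hstart
  have hlt := index_lt_of_expansions hhpos hNpos hDpos hκ0 hκ1 hε hε1 hεδ hgap m1 m2 opt neg1 neg2
    negm tay2 tay1 (ENNReal.toReal_mono p1.1 hstart)
  rcases fin_two_eq_or 1 (α (t + h)) with hα | hα
  · exact hα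
  exfalso
  have hα : α (t + h) = 0 := hα
  have hf := htyp.follows (t + h) (by omega) 1
  rw [hα, armIndex_zero (by omega), armIndex_one (by omega)] at hf
  have := ENNReal.toReal_mono q0.1 hf
  rw [s0, v0, v1, Nat.cast_add (visits α 1 t)] at this
  exact absurd hlt (not_lt.2 this)

theorem sum_rewardValue_eq_card (r : ℕ → Bool) (t h : ℕ) :
    ∃ k ∈ Finset.range (h + 1), ∑ i ∈ Finset.range h, rewardValue (r (t + i)) = k := by
  refine ⟨((Finset.range h).filter fun i => r (t + i) = true).card, ?_, ?_⟩
  · rw [Finset.mem_range, Nat.lt_succ_iff]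
    exact (Finset.card_filter_le _ _).trans (by simp)
  · simp [rewardValue]

/-- In the long run, arm 2 is played again as long as the rewards of the current exploration are
good enough. -/
theorem IsTypical.eventually_play (hI : IsRegularIndex I Imax μ₁ μ₂ L ρ) (hμ₂ : 0 < μ₂)
    (hμ : μ₂ < μ₁) (hμ₁ : μ₁ < 1) (htyp : IsTypical I μ₁ μ₂ α r) {h : ℕ} (hh : 1 ≤ h) :
    ∀ᶠ t : ℕ in atTop, (∀ i < h, α (t + i) = 1) →
      0 < -(ρ * (1 - μ₂)) + ((∑ i ∈ Finset.range h, rewardValue (r (t + i))) / h - μ₂) →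
      α (t + h) = 1 := by
  -- The average takes only the values `k / h` with `k ≤ h`, so mere positivity supplies a fixed gap
  -- for each `k`.
  have key : ∀ k ∈ Finset.range (h + 1), ∀ᶠ t : ℕ in atTop, (∀ i < h, α (t + i) = 1) →
      0 < -(ρ * (1 - μ₂)) + ((k : ℝ) / h - μ₂) →
      ∑ i ∈ Finset.range h, rewardValue (r (t + i)) = k → α (t + h) = 1 := by
    intro k _
    by_cases hk : 0 < -(ρ * (1 - μ₂)) + ((k : ℝ) / h - μ₂)
    · filter_upwards [htyp.eventually_play_of_gap hI hμ₂ hμ hμ₁ hh hk] with t ht h1 _ h3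
      exact ht h1 (by rw [h3])
    · exact Eventually.of_forall fun t _ h2 => absurd h2 hk
  filter_upwards [(Finset.eventually_all _).2 key] with t ht h1 h2
  obtain ⟨k, hk, hsum⟩ := sum_rewardValue_eq_card r t h
  exact ht k hk h1 (by rwa [hsum] at h2) hsum

end Stay

/-! ## Sliding regret -/

theorem rewardLaw_true_pos {q : unitInterval} (hq : 0 < (q : ℝ)) : rewardLaw q {true} ≠ 0 := by
  classical
  rw [bernoulliMeasure_apply q (measurableSet_singleton _)]
  simp only [Set.mem_singleton_iff, if_true, Bool.false_eq_true, if_false]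
  intro h
  rw [ENNReal.coe_eq_zero] at h
  have := congrArg NNReal.toReal h
  exact hq.ne' this

/-- Runs of successes of any given length occur infinitely often. -/
theorem ae_frequently_successes {q : unitInterval} (hq : 0 < (q : ℝ)) (T : ℕ) :
    ∀ᵐ x ∂Measure.infinitePi fun _ : ℕ => rewardLaw q,
      ∃ᶠ n in atTop, ∀ i < T, x (n + i) = true := by
  rcases Nat.eq_zero_or_pos T with rfl | hT
  · exact ae_of_all _ fun x => Frequently.of_forall fun n i hi => absurd hi (Nat.not_lt_zero _)
  set κ := Measure.infinitePi fun _ : ℕ => rewardLaw q with hκ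
  -- Disjoint blocks make the events independent with a common positive probability, as the second
  -- Borel–Cantelli lemma requires.
  set b : ℕ → Finset ℕ := fun n => Finset.Ico (n * T) (n * T + T) with hb
  set s : ℕ → Set (ℕ → Bool) := fun n => Set.pi (b n : Set ℕ) fun _ => {true} with hs
  have hbox : ∀ F : Finset ℕ, κ (Set.pi (F : Set ℕ) fun _ => {true}) =
      ∏ _i ∈ F, rewardLaw q {true} := fun F =>
    Measure.infinitePi_pi _ fun _ _ => measurableSet_singleton _
  have hsm : ∀ n, MeasurableSet (s n) := fun n =>
    .pi (Finset.countable_toSet _) fun _ _ => measurableSet_singleton _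
  have hdisj : ∀ m n, m ≠ n → Disjoint (b m) (b n) := by
    intro m n hmn
    rw [Finset.disjoint_left]
    intro i hi hj
    simp only [hb, Finset.mem_Ico] at hi hj
    refine hmn ?_
    have h1 : i / T = m := Nat.div_eq_of_lt_le hi.1 (by rw [add_mul, one_mul]; exact hi.2)
    have h2 : i / T = n := Nat.div_eq_of_lt_le hj.1 (by rw [add_mul, one_mul]; exact hj.2)
    exact h1.symm.trans h2
  have hind : iIndepSet s κ := by
    rw [iIndepSet_iff_meas_biInter hsm]
    intro F
    have e : (⋂ n ∈ F, s n) = Set.pi (F.biUnion b : Set ℕ) fun _ => {true} := by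
      ext x
      simp only [hs, Set.mem_iInter, Set.mem_pi, Finset.coe_biUnion, Set.mem_iUnion]
      exact ⟨fun h i ⟨n, hn, hi⟩ => h n hn i hi, fun h n hn i hi => h i ⟨n, hn, hi⟩⟩
    rw [e, hbox, Finset.prod_biUnion fun m _ n _ hmn => hdisj m n hmn]
    exact Finset.prod_congr rfl fun n _ => (hbox _).symm
  have hsum : ∑' n, κ (s n) = ⊤ := by
    have : ∀ n, κ (s n) = rewardLaw q {true} ^ T := fun n => by
      rw [hs]; simp only [hbox]
      simp [hb]
    simp_rw [this]
    exact ENNReal.tsum_const_eq_top_of_ne_zero (pow_ne_zero _ (rewardLaw_true_pos hq))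
  have hlim := measure_limsup_eq_one hsm hind hsum
  have hlm : MeasurableSet (limsup s atTop) := .measurableSet_limsup hsm
  filter_upwards [(mem_ae_iff_prob_eq_one hlm).2 hlim] with x hx
  rw [mem_limsup_iff_frequently_mem] at hx
  have hmul : Tendsto (fun n : ℕ => n * T) atTop atTop :=
    tendsto_id.atTop_mul_const' hT
  refine hmul.frequently (hx.mono fun n hn i hi => ?_)
  exact hn (n * T + i) (by simp only [hb, Finset.coe_Ico, Set.mem_Ico]; omega)

theorem nth_add_of_forall {p : ℕ → Prop} (hinf : (Set.ofPred p).Infinite) {n h : ℕ}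
    (hp : ∀ i ≤ h, p (Nat.nth p n + i)) : Nat.nth p (n + h) = Nat.nth p n + h := by
  classical
  have key : ∀ i ≤ h, Nat.count p (Nat.nth p n + i) = n + i := by
    intro i hi
    induction i with
    | zero => exact Nat.count_nth_of_infinite hinf n
    | succ i ih =>
      rw [← add_assoc, Nat.count_succ, ih (by omega), if_pos (hp i (by omega)), add_assoc]
  rw [← key h le_rfl, Nat.nth_count (hp h le_rfl)]

section Sliding

variable {I : ℝ → ℝ → ℝ → ℝ → ℝ≥0∞} {Imax : ℝ≥0∞} {μ₁ μ₂ L ρ : ℝ} {α : ℕ → Fin 2} {r : ℕ → Bool}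

/-- Start at a play of arm 2 opening a run of `T` successes. Inductively, while arm 2 is played
without interruption the next rewards of the run are those observed in the window, and average `1`
exceeds the threshold because `ρ < 1`. -/
theorem IsTypical.frequently_plays (hI : IsRegularIndex I Imax μ₁ μ₂ L ρ) (hμ₂ : 0 < μ₂)
    (hμ : μ₂ < μ₁) (hμ₁ : μ₁ < 1) (htyp : IsTypical I μ₁ μ₂ α r) {T : ℕ}
    (hones : ∃ᶠ n in atTop, ∀ i < T, r (Nat.nth (playsArm 1 α) (n + i)) = true) :
    ∃ᶠ t in atTop, ∀ i < T, α (t + i) = 1 := by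
  have hinf := htyp.infinite_plays hI hμ₂ hμ hμ₁ 1
  have hev : ∀ᶠ t : ℕ in atTop, ∀ h ∈ Finset.Ico 1 T, (∀ i < h, α (t + i) = 1) →
      0 < -(ρ * (1 - μ₂)) + ((∑ i ∈ Finset.range h, rewardValue (r (t + i))) / h - μ₂) →
      α (t + h) = 1 :=
    (Finset.eventually_all _).2 fun h hh =>
      htyp.eventually_play hI hμ₂ hμ hμ₁ (Finset.mem_Ico.1 hh).1
  have htend : Tendsto (Nat.nth (playsArm 1 α)) atTop atTop := (Nat.nth_strictMono hinf).tendsto_atTop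
  refine htend.frequently ((hones.and_eventually (htend.eventually hev)).mono ?_)
  rintro n ⟨h1, h2⟩ i hi
  set t := Nat.nth (playsArm 1 α) n with ht
  have hmem : playsArm 1 α t := Nat.nth_mem_of_infinite hinf n
  have ht1 : 1 ≤ t := hmem.1
  induction i using Nat.strong_induction_on with
  | _ i ih =>
    rcases Nat.eq_zero_or_pos i with rfl | hi0
    · exact hmem.2
    · have hprev : ∀ j < i, α (t + j) = 1 := fun j hj => ih j hj (hj.trans hi)
      refine h2 i (Finset.mem_Ico.2 ⟨hi0, hi⟩) hprev ?_
      have hone : ∀ j ∈ Finset.range i, rewardValue (r (t + j)) = 1 := by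
        intro j hj
        rw [Finset.mem_range] at hj
        have := h1 j (hj.trans hi)
        rw [nth_add_of_forall hinf fun k hk => ⟨by omega, hprev k (by omega)⟩] at this
        simp [rewardValue, ht, this]
      rw [Finset.sum_congr rfl hone]
      have hi' : (i : ℝ) ≠ 0 := by exact_mod_cast hi0.ne'
      simp only [Finset.sum_const, Finset.card_range, nsmul_eq_mul, mul_one, div_self hi']
      have := hI.rho_lt_one
      have : 0 < (1 - ρ) * (1 - μ₂) := mul_pos (by linarith) (by linarith)
      linarith

theorem slidingRegret_eq (hμ : μ₂ < μ₁) {T : ℕ}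
    (hα : ∃ᶠ t in atTop, ∀ i < T, α (t + i) = 1) :
    slidingRegret μ₁ μ₂ α T = (μ₁ - μ₂) * T := by
  have hle : ∀ t, (T : ℝ) * μ₁ - ∑ i ∈ Finset.Icc 1 T, armMean μ₁ μ₂ (α (t + i)) ≤
      (μ₁ - μ₂) * T := by
    intro t
    have : ∑ _i ∈ Finset.Icc 1 T, μ₂ ≤ ∑ i ∈ Finset.Icc 1 T, armMean μ₁ μ₂ (α (t + i)) := by
      refine Finset.sum_le_sum fun i _ => ?_
      rcases fin_two_eq_or 0 (α (t + i)) with h | h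
      · rw [h]; exact hμ.le
      · rw [h]; exact le_rfl
    simp only [Finset.sum_const, Nat.card_Icc, Nat.add_sub_cancel, nsmul_eq_mul] at this
    linarith
  have hge : ∀ t, (T : ℝ) * μ₁ - ∑ _i ∈ Finset.Icc 1 T, μ₁ ≤
      (T : ℝ) * μ₁ - ∑ i ∈ Finset.Icc 1 T, armMean μ₁ μ₂ (α (t + i)) := fun t =>
    sub_le_sub_left (Finset.sum_le_sum fun i _ => armMean_le hμ _) _
  have hbdd : IsBoundedUnder (· ≤ ·) atTop
      (fun t : ℕ => (T : ℝ) * μ₁ - ∑ i ∈ Finset.Icc 1 T, armMean μ₁ μ₂ (α (t + i))) :=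
    isBoundedUnder_of ⟨_, hle⟩
  have hcobdd : IsCoboundedUnder (· ≤ ·) atTop
      (fun t : ℕ => (T : ℝ) * μ₁ - ∑ i ∈ Finset.Icc 1 T, armMean μ₁ μ₂ (α (t + i))) :=
    (isBoundedUnder_of ⟨_, hge⟩ : IsBoundedUnder (· ≥ ·) atTop _).isCoboundedUnder_le
  refine le_antisymm (limsup_le_of_le hcobdd (Eventually.of_forall hle))
    (le_limsup_of_frequently_le ?_ hbdd)
  -- The sliding window opens at `t + 1`, hence the shift by one.
  have hsub : ∃ᶠ t in atTop, ∀ i ∈ Finset.Icc 1 T, α (t + i) = 1 := by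
    rw [frequently_atTop] at hα ⊢
    intro a
    obtain ⟨t, ht, h⟩ := hα (a + 1)
    refine ⟨t - 1, by omega, fun i hi => ?_⟩
    rw [Finset.mem_Icc] at hi
    have := h (i - 1) (by omega)
    rwa [show t + (i - 1) = t - 1 + i by omega] at this
  refine hsub.mono fun t ht => ?_
  have : ∑ i ∈ Finset.Icc 1 T, armMean μ₁ μ₂ (α (t + i)) = ∑ _i ∈ Finset.Icc 1 T, μ₂ :=
    Finset.sum_congr rfl fun i hi => by rw [ht i hi]; rfl
  rw [this]
  simp only [Finset.sum_const, Nat.card_Icc, Nat.add_sub_cancel, nsmul_eq_mul]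
  linarith

end Sliding

/-! ## Exploration episodes -/

section Exploration

variable {α : ℕ → Fin 2}

/-- After any time there is a play of arm 1 and then a first return to arm 2, which starts a new
episode. The bound `k + 1 ≤ τ` makes "for large times" imply "for large `k`". -/
theorem explorationTime_spec (hinf : ∀ a, (Set.ofPred (playsArm a α)).Infinite) (k : ℕ) :
    ∃ τ : ℕ, explorationTime α k = τ ∧ k + 1 ≤ τ ∧ α τ = 1 := by
  induction k with
  | zero =>
    have hne : {τ : ℕ∞ | ∃ t : ℕ, τ = (t : ℕ∞) ∧ 1 ≤ t ∧ α t = 1}.Nonempty := by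
      obtain ⟨t, ht, -⟩ := (hinf 1).exists_gt 0
      exact ⟨t, t, rfl, ht.1, ht.2⟩
    obtain ⟨t, ht, h1, h2⟩ := csInf_mem hne
    exact ⟨t, ht, by omega, h2⟩
  | succ k ih =>
    obtain ⟨τ, hτ, hk, -⟩ := ih
    have hne : {σ : ℕ∞ | ∃ t : ℕ, σ = (t : ℕ∞) ∧ explorationTime α k < (t : ℕ∞) ∧
        α t = 1 ∧ α (t - 1) = 0}.Nonempty := by
      obtain ⟨s, hs, hτs⟩ := (hinf 0).exists_gt τ
      have hex : ∃ t, s < t ∧ α t = 1 := by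
        obtain ⟨t, ht, hst⟩ := (hinf 1).exists_gt s
        exact ⟨t, hst, ht.2⟩
      classical
      obtain ⟨h1, h2⟩ := Nat.find_spec hex
      refine ⟨_, Nat.find hex, rfl, ?_, h2, ?_⟩
      · rw [hτ]; exact_mod_cast hτs.trans h1
      · rcases lt_or_eq_of_le (Nat.le_sub_one_of_lt h1) with h3 | h3
        · have := Nat.find_min hex (m := Nat.find hex - 1) (by omega)
          rcases fin_two_eq_or 0 (α (Nat.find hex - 1)) with h0 | h0
          · exact h0
          · exact absurd ⟨h3, h0⟩ this
        · rw [← h3]; exact hs.2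
    obtain ⟨t, ht, h1, h2, -⟩ := csInf_mem hne
    refine ⟨t, ht, ?_, h2⟩
    rw [hτ] at h1
    have : τ < t := by exact_mod_cast h1
    omega

theorem one_le_explorationTime (α : ℕ → Fin 2) (k : ℕ) : 1 ≤ explorationTime α k := by
  induction k with
  | zero =>
    refine le_sInf ?_
    rintro _ ⟨t, rfl, h1, -⟩
    exact_mod_cast h1
  | succ k ih =>
    refine le_sInf ?_
    rintro _ ⟨t, rfl, h1, -⟩
    exact ih.trans h1.le

/-- Stopping-time property: an infimum bounded by `t` is attained, and its witness only involves
arms up to `t`. The argument is symmetric in the two trajectories. -/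
theorem explorationTime_congr {α α' : ℕ → Fin 2} {t : ℕ}
    (h : ∀ i ∈ Finset.Icc 1 t, α i = α' i) (k : ℕ) (hk : explorationTime α k ≤ t) :
    explorationTime α' k = explorationTime α k := by
  have hfin : ∀ S : Set ℕ∞, sInf S ≤ (t : ℕ∞) → S.Nonempty := by
    intro S hS
    by_contra hne
    rw [Set.not_nonempty_iff_eq_empty] at hne
    rw [hne, sInf_empty] at hS
    exact absurd hS (by simp)
  induction k generalizing α α' with
  | zero =>
    have step : ∀ β β' : ℕ → Fin 2, (∀ i ∈ Finset.Icc 1 t, β i = β' i) →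
        explorationTime β 0 ≤ t → explorationTime β' 0 ≤ explorationTime β 0 := by
      intro β β' hb hle
      obtain ⟨s, hs, h1, h2⟩ := csInf_mem (hfin _ hle)
      have hs' : explorationTime β 0 = s := hs
      rw [hs'] at hle ⊢
      have hst : s ≤ t := by exact_mod_cast hle
      exact sInf_le ⟨s, rfl, h1, by rw [← hb s (Finset.mem_Icc.2 ⟨h1, hst⟩), h2]⟩
    have h1 := step α α' h hk
    exact le_antisymm h1 (step α' α (fun i hi => (h i hi).symm) (h1.trans hk))
  | succ k ih =>
    have step : ∀ β β' : ℕ → Fin 2, (∀ i ∈ Finset.Icc 1 t, β i = β' i) →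
        explorationTime β (k + 1) ≤ t →
        explorationTime β' (k + 1) ≤ explorationTime β (k + 1) := by
      intro β β' hb hle
      obtain ⟨s, hs, h1, h2, h3⟩ := csInf_mem (hfin _ hle)
      have hs' : explorationTime β (k + 1) = s := hs
      rw [hs'] at hle ⊢
      have hst : s ≤ t := by exact_mod_cast hle
      -- Hence `s - 1 ≥ 1`: the meaningless arm at time `0` is never consulted.
      have h4 : (1 : ℕ∞) < s := (one_le_explorationTime β k).trans_lt h1
      have h5 : 1 < s := by exact_mod_cast h4
      have h6 := ih hb (h1.le.trans hle)
      refine sInf_le ⟨s, rfl, by rwa [h6], ?_, ?_⟩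
      · rw [← hb s (Finset.mem_Icc.2 ⟨h5.le, hst⟩), h2]
      · rw [← hb (s - 1) (Finset.mem_Icc.2 ⟨by omega, by omega⟩), h3]
    have h1 := step α α' h hk
    exact le_antisymm h1 (step α' α (fun i hi => (h i hi).symm) (h1.trans hk))

/-- The selection of the plays of arm 2 from the `k`-th exploration episode on. -/
def playsAfter (k : ℕ) (α : ℕ → Fin 2) (t : ℕ) : Prop :=
  explorationTime α k ≤ t ∧ 1 ≤ t ∧ α t = 1

/-- Whether the `k`-th episode has begun by time `t` is decided by the arms up to `t`, so the
rewards from that episode on are collected at predictable times. -/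
theorem isSelection_playsAfter (k : ℕ) : IsSelection 1 (playsAfter k) where
  one_le _ _ h := h.2.1
  arm_eq _ _ h := h.2.2
  congr _ _ t h hp := ⟨(explorationTime_congr h k hp.1).trans_le hp.1, hp.2.1,
    (h t (Finset.mem_Icc.2 ⟨hp.2.1, le_rfl⟩)) ▸ hp.2.2⟩

theorem infinite_playsAfter (hinf : ∀ a, (Set.ofPred (playsArm a α)).Infinite) (k : ℕ) :
    (Set.ofPred (playsAfter k α)).Infinite := by
  obtain ⟨τ, hτ, -, -⟩ := explorationTime_spec hinf k
  refine Set.infinite_of_forall_exists_gt fun n => ?_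
  obtain ⟨t, ht, hlt⟩ := (hinf 1).exists_gt (max n τ)
  refine ⟨t, ⟨?_, ht.1, ht.2⟩, (le_max_left _ _).trans_lt hlt⟩
  rw [hτ]
  exact_mod_cast (le_max_right n τ).trans hlt.le

theorem nth_playsAfter_zero (hinf : ∀ a, (Set.ofPred (playsArm a α)).Infinite) (k : ℕ) :
    Nat.nth (playsAfter k α) 0 = (explorationTime α k).toNat := by
  obtain ⟨τ, hτ, h1, h2⟩ := explorationTime_spec hinf k
  rw [Nat.nth_zero, hτ, ENat.toNat_natCast]
  have hmem : playsAfter k α τ := ⟨hτ.le, by omega, h2⟩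
  refine le_antisymm (Nat.sInf_le hmem) ?_
  have hne : (Set.ofPred (playsAfter k α)).Nonempty := ⟨τ, hmem⟩
  have h3 := (Nat.sInf_mem hne).1
  rw [hτ] at h3
  exact_mod_cast h3

end Exploration

/-! ## The clipped hitting time -/

theorem lt_clippedHittingTime_iff {μ₂ ρ : ℝ} {x : ℕ → ℝ} {T j : ℕ} :
    j < clippedHittingTime μ₂ ρ x T ↔ j < T ∧ ∀ t, 1 ≤ t → t ≤ j →
      0 < -(ρ * (1 - μ₂)) + (1 / (t : ℝ)) * ∑ i ∈ Finset.Icc 1 t, (x i - μ₂) := by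
  set S : Set ℕ∞ := {τ : ℕ∞ | ∃ t : ℕ, τ = (t : ℕ∞) ∧ 1 ≤ t ∧
    -(ρ * (1 - μ₂)) + (1 / (t : ℝ)) * ∑ i ∈ Finset.Icc 1 t, (x i - μ₂) ≤ 0} with hS
  have hne : min (T : ℕ∞) (sInf S) ≠ ⊤ :=
    ne_top_of_le_ne_top (ENat.natCast_ne_top T) (min_le_left _ _)
  have h1 : j < clippedHittingTime μ₂ ρ x T ↔ (j : ℕ∞) < min (T : ℕ∞) (sInf S) := by
    rw [← ENat.natCast_toNat hne, Nat.cast_lt]; rfl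
  rw [h1, lt_min_iff, Nat.cast_lt]
  refine and_congr_right fun _ => ⟨fun h t ht htj => ?_, fun h => ?_⟩
  · by_contra! hle
    have : sInf S ≤ (t : ℕ∞) := sInf_le ⟨t, rfl, ht, hle⟩
    have h2 : (t : ℕ∞) ≤ j := by exact_mod_cast htj
    exact absurd h (not_lt.2 (this.trans h2))
  · rcases S.eq_empty_or_nonempty with he | he
    · rw [he, sInf_empty]; exact ENat.natCast_lt_top j
    · obtain ⟨t, ht, h2, h3⟩ := csInf_mem he
      rw [ht]
      by_contra! hle
      exact absurd (h t h2 (by exact_mod_cast hle)) (not_lt.2 h3)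

theorem clippedHittingTime_le (μ₂ ρ : ℝ) (x : ℕ → ℝ) (T : ℕ) :
    clippedHittingTime μ₂ ρ x T ≤ T := by
  by_contra! h
  exact absurd (lt_clippedHittingTime_iff.1 h).1 (lt_irrefl _)

theorem clippedHittingTime_congr {μ₂ ρ : ℝ} {x y : ℕ → ℝ} (h : ∀ i, 1 ≤ i → x i = y i) (T : ℕ) :
    clippedHittingTime μ₂ ρ x T = clippedHittingTime μ₂ ρ y T := by
  have key : ∀ j, j < clippedHittingTime μ₂ ρ x T ↔ j < clippedHittingTime μ₂ ρ y T := by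
    intro j
    rw [lt_clippedHittingTime_iff, lt_clippedHittingTime_iff]
    refine and_congr_right fun _ => forall_congr' fun t => forall_congr' fun _ =>
      forall_congr' fun _ => ?_
    rw [Finset.sum_congr rfl fun i hi => by rw [h i (Finset.mem_Icc.1 hi).1]]
  exact le_antisymm (not_lt.1 fun hlt => absurd ((key _).1 hlt) (lt_irrefl _))
    (not_lt.1 fun hlt => absurd ((key _).2 hlt) (lt_irrefl _))

/-- The clipped hitting time of a sequence of boolean rewards numbered from `0`. -/
noncomputable def rewardHittingTime (μ₂ ρ : ℝ) (T : ℕ) (x : ℕ → Bool) : ℕ :=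
  clippedHittingTime μ₂ ρ (fun i => rewardValue (x (i - 1))) T

theorem sum_Icc_pred (f : ℕ → ℝ) (t : ℕ) :
    ∑ i ∈ Finset.Icc 1 t, f (i - 1) = ∑ i ∈ Finset.range t, f i := by
  rw [← Finset.Ico_add_one_right_eq_Icc, Finset.sum_Ico_eq_sum_range]
  simp

theorem lt_rewardHittingTime_iff {μ₂ ρ : ℝ} {x : ℕ → Bool} {T j : ℕ} :
    j < rewardHittingTime μ₂ ρ T x ↔ j < T ∧ ∀ t, 1 ≤ t → t ≤ j →
      0 < -(ρ * (1 - μ₂)) + ((∑ i ∈ Finset.range t, rewardValue (x i)) / t - μ₂) := by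
  rw [rewardHittingTime, lt_clippedHittingTime_iff]
  refine and_congr_right fun _ => forall_congr' fun t => forall_congr' fun ht =>
    forall_congr' fun _ => ?_
  have ht' : (t : ℝ) ≠ 0 := by exact_mod_cast (by omega : t ≠ 0)
  have e : (1 / (t : ℝ)) * ∑ i ∈ Finset.Icc 1 t, (rewardValue (x (i - 1)) - μ₂) =
      (∑ i ∈ Finset.range t, rewardValue (x i)) / t - μ₂ := by
    rw [sum_Icc_pred (fun i => rewardValue (x i) - μ₂), Finset.sum_sub_distrib]
    simp only [Finset.sum_const, Finset.card_range, nsmul_eq_mul]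
    field_simp
  rw [e]

theorem measurable_rewardHittingTime (μ₂ ρ : ℝ) (T : ℕ) :
    Measurable (rewardHittingTime μ₂ ρ T) := by
  refine measurable_of_Ioi fun j => ?_
  have hf : Measurable rewardValue := measurable_of_finite _
  have e : rewardHittingTime μ₂ ρ T ⁻¹' Set.Ioi j = {_x | j < T} ∩ ⋂ t, ⋂ (_ : 1 ≤ t),
      ⋂ (_ : t ≤ j), {x | 0 < -(ρ * (1 - μ₂)) +
        ((∑ i ∈ Finset.range t, rewardValue (x i)) / t - μ₂)} := by
    ext x
    simp [lt_rewardHittingTime_iff]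
  rw [e]
  refine (MeasurableSet.const _).inter (.iInter fun t => .iInter fun _ => .iInter fun _ =>
    measurableSet_lt measurable_const ?_)
  exact (((Finset.measurable_sum _ fun i _ => hf.comp (measurable_pi_apply i)).div_const
    _).sub_const _).const_add _

/-! ## Regret of exploration -/

section Window

variable {I : ℝ → ℝ → ℝ → ℝ → ℝ≥0∞} {Imax : ℝ≥0∞} {μ₁ μ₂ L ρ : ℝ} {α : ℕ → Fin 2} {r : ℕ → Bool}

theorem windowRegret_nonneg (hμ : μ₂ < μ₁) (α : ℕ → Fin 2) (s T : ℕ) :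
    0 ≤ windowRegret μ₁ μ₂ α s T :=
  Finset.sum_nonneg fun _ _ => sub_nonneg.2 (armMean_le hμ _)

theorem windowRegret_le (hμ : μ₂ < μ₁) (α : ℕ → Fin 2) (s T : ℕ) :
    windowRegret μ₁ μ₂ α s T ≤ (μ₁ - μ₂) * T := by
  have : ∑ i ∈ Finset.range T, (μ₁ - armMean μ₁ μ₂ (α (s + i))) ≤
      ∑ _i ∈ Finset.range T, (μ₁ - μ₂) := by
    refine Finset.sum_le_sum fun i _ => sub_le_sub_left ?_ _
    rcases fin_two_eq_or 0 (α (s + i)) with h | h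
    · rw [h]; exact hμ.le
    · rw [h]; exact le_rfl
  simp only [Finset.sum_const, Finset.card_range, nsmul_eq_mul] at this
  rw [windowRegret]; linarith

theorem le_windowRegret (hμ : μ₂ < μ₁) {s T f : ℕ} (hf : f ≤ T) (h : ∀ i < f, α (s + i) = 1) :
    (μ₁ - μ₂) * f ≤ windowRegret μ₁ μ₂ α s T := by
  calc (μ₁ - μ₂) * f = ∑ i ∈ Finset.range f, (μ₁ - armMean μ₁ μ₂ (α (s + i))) := by
        rw [Finset.sum_congr rfl fun i hi => by rw [h i (Finset.mem_range.1 hi)]]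
        simp [armMean]; ring
    _ ≤ windowRegret μ₁ μ₂ α s T :=
        Finset.sum_le_sum_of_subset_of_nonneg (Finset.range_subset_range.2 hf)
          fun _ _ _ => sub_nonneg.2 (armMean_le hμ _)

/-- Eventually, an exploration lasts at least as long as its clipped hitting time. -/
theorem IsTypical.eventually_le_windowRegret (hI : IsRegularIndex I Imax μ₁ μ₂ L ρ) (hμ₂ : 0 < μ₂)
    (hμ : μ₂ < μ₁) (hμ₁ : μ₁ < 1) (htyp : IsTypical I μ₁ μ₂ α r) (T : ℕ) :
    ∀ᶠ k in atTop, (μ₁ - μ₂) *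
        (rewardHittingTime μ₂ ρ T fun n => r (Nat.nth (playsAfter k α) n) : ℕ) ≤
      windowRegret μ₁ μ₂ α (explorationTime α k).toNat T := by
  have hinf := htyp.infinite_plays hI hμ₂ hμ hμ₁
  have hev : ∀ᶠ t : ℕ in atTop, ∀ h ∈ Finset.Ico 1 T, (∀ i < h, α (t + i) = 1) →
      0 < -(ρ * (1 - μ₂)) + ((∑ i ∈ Finset.range h, rewardValue (r (t + i))) / h - μ₂) →
      α (t + h) = 1 :=
    (Finset.eventually_all _).2 fun h hh =>
      htyp.eventually_play hI hμ₂ hμ hμ₁ (Finset.mem_Ico.1 hh).1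
  obtain ⟨t₀, ht₀⟩ := eventually_atTop.1 hev
  -- Enough because the `k`-th episode starts no earlier than time `k + 1`.
  filter_upwards [eventually_ge_atTop t₀] with k hk
  refine le_windowRegret hμ (clippedHittingTime_le _ _ _ _) fun j hj => ?_
  have hinfk := infinite_playsAfter hinf k
  have hz := nth_playsAfter_zero hinf k
  obtain ⟨τ, hτ, hkτ, hατ⟩ := explorationTime_spec hinf k
  rw [hτ, ENat.toNat_natCast] at hz ⊢
  change j < rewardHittingTime μ₂ ρ T _ at hj
  induction j using Nat.strong_induction_on with
  | _ j ih =>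
    rcases Nat.eq_zero_or_pos j with rfl | hj0
    · exact hατ
    · have hprev : ∀ i < j, α (τ + i) = 1 := fun i hi => ih i hi (hi.trans hj)
      obtain ⟨hjT, hpos⟩ := lt_rewardHittingTime_iff.1 hj
      refine ht₀ τ (by omega) j (Finset.mem_Ico.2 ⟨hj0, hjT⟩) hprev ?_
      have := hpos j hj0 le_rfl
      -- As long as arm 2 has been played without interruption since `τ`, the `i`-th selected time
      -- is `τ + i`.
      have e : ∀ i ∈ Finset.range j, rewardValue (r (Nat.nth (playsAfter k α) i)) =
          rewardValue (r (τ + i)) := by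
        intro i hi
        rw [Finset.mem_range] at hi
        have h1 := nth_add_of_forall hinfk (n := 0) (h := i) fun l hl => by
          rw [hz]
          refine ⟨?_, by omega, hprev l (by omega)⟩
          rw [hτ]; exact_mod_cast Nat.le_add_right τ l
        rw [zero_add, hz] at h1
        rw [h1]
      rwa [Finset.sum_congr rfl e] at this

end Window

/-- The expected clipped hitting time only depends on the law of the rewards. -/
theorem integral_clippedHittingTime {Ω' : Type*} [MeasurableSpace Ω'] (Q : Measure Ω')
    {X : ℕ → Ω' → ℝ} (hX_indep : iIndepFun X Q) {q : unitInterval}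
    (hX_law : ∀ i, HasLaw (X i) (bernoulliMeasure (1 : ℝ) 0 q) Q) (μ₂ ρ : ℝ) (T : ℕ) :
    ∫ ω, (clippedHittingTime μ₂ ρ (fun i => X i ω) T : ℝ) ∂Q =
      ∫ x, (rewardHittingTime μ₂ ρ T x : ℝ) ∂Measure.infinitePi fun _ : ℕ => rewardLaw q := by
  classical
  have := hX_indep.isProbabilityMeasure
  set d : ℝ → Bool := fun x => decide (x = 1) with hd
  have hdm : Measurable d := measurable_to_bool (by
    have : d ⁻¹' {true} = {1} := by ext x; simp [hd]
    rw [this]; exact measurableSet_singleton _)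
  have hX' : ∀ i, HasLaw (fun ω => d (X (i + 1) ω)) (rewardLaw q) Q := fun i =>
    ⟨hdm.comp_aemeasurable (hX_law (i + 1)).aemeasurable, by
      have h1 := AEMeasurable.map_map_of_aemeasurable (hdm.aemeasurable)
        (hX_law (i + 1)).aemeasurable
      rw [(hX_law (i + 1)).map_eq, map_bernoulliMeasure' _ _ hdm] at h1
      rw [show (fun ω => d (X (i + 1) ω)) = d ∘ X (i + 1) from rfl, ← h1]
      simp [hd, rewardLaw]⟩
  -- The hitting time reads `X` from index `1` on, whereas boolean sequences are numbered from `0`.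
  have hind : iIndepFun (fun i ω => d (X (i + 1) ω)) Q :=
    (hX_indep.precomp (g := fun i : ℕ => i + 1) (add_left_injective 1)).comp (fun _ => d)
      fun _ => hdm
  have hlaw := hind.hasLaw_infinitePi hX' (aemeasurable_pi_iff.2 fun i => (hX' i).aemeasurable)
  have hval : ∀ᵐ ω ∂Q, ∀ i, X i ω = 1 ∨ X i ω = 0 := by
    refine ae_all_iff.2 fun i => ?_
    have hm : MeasurableSet {x : ℝ | ¬(x = 1 ∨ x = 0)} := by
      have : {x : ℝ | ¬(x = 1 ∨ x = 0)} = ({1, 0} : Set ℝ)ᶜ := by ext x; simp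
      rw [this]; exact (Set.toFinite _).measurableSet.compl
    rw [ae_iff, (hX_law i).measure_eq hm]
    exact bernoulliMeasure_apply_of_notMem_of_notMem q hm (by simp) (by simp)
  have hfm : Measurable fun x : ℕ → Bool => (rewardHittingTime μ₂ ρ T x : ℝ) :=
    measurable_from_nat.comp (measurable_rewardHittingTime μ₂ ρ T)
  rw [← hlaw.map_eq, integral_map hlaw.aemeasurable hfm.aestronglyMeasurable]
  refine integral_congr_ae ?_
  filter_upwards [hval] with ω hω
  refine congrArg Nat.cast (clippedHittingTime_congr (fun i hi => ?_) T)
  change X i ω = rewardValue (d (X (i - 1 + 1) ω))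
  rw [Nat.sub_add_cancel hi]
  rcases hω i with h | h <;> simp [h, hd, rewardValue]

section Exploration

variable {Ω : Type*} [MeasurableSpace Ω] {P : Measure Ω} [IsProbabilityMeasure P]
  {I : ℝ → ℝ → ℝ → ℝ → ℝ≥0∞} {Imax : ℝ≥0∞} {μ₁ μ₂ L ρ : ℝ}
  {A : ℕ → Ω → Fin 2} {R : ℕ → Ω → Bool}

/-- The lower bound `F k` has the same mean for every `k`, since the rewards from the `k`-th episode
on are i.i.d. The pathwise bound holds only from a random rank on, but the negative part of `G k - F
k` is bounded and eventually zero almost surely, so its mean tends to `0`. -/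
theorem le_regretOfExploration (hμ₂ : 0 < μ₂) (hμ : μ₂ < μ₁) (hμ₁ : μ₁ < 1)
    (hI : IsRegularIndex I Imax μ₁ μ₂ L ρ) (hrun : IsBanditRun P μ₁ μ₂ A R)
    (htyp : ∀ᵐ ω ∂P, IsTypical I μ₁ μ₂ (fun t => A t ω) (fun t => R t ω))
    {q : unitInterval} (hq : (q : ℝ) = μ₂) (T : ℕ) :
    (μ₁ - μ₂) *
        ∫ x, (rewardHittingTime μ₂ ρ T x : ℝ) ∂Measure.infinitePi (fun _ : ℕ => rewardLaw q) ≤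
      regretOfExploration P μ₁ μ₂ A T := by
  have hinf : ∀ᵐ ω ∂P, ∀ a, (Set.ofPred (playsArm a fun t => A t ω)).Infinite := by
    filter_upwards [htyp] with ω hω using hω.infinite_plays hI hμ₂ hμ hμ₁
  set c := (μ₁ - μ₂) *
    ∫ x, (rewardHittingTime μ₂ ρ T x : ℝ) ∂Measure.infinitePi (fun _ : ℕ => rewardLaw q) with hc
  set G : ℕ → Ω → ℝ := fun k ω =>
    windowRegret μ₁ μ₂ (fun t => A t ω) (explorationTime (fun t => A t ω) k).toNat T with hG
  set F : ℕ → Ω → ℝ := fun k ω =>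
    (μ₁ - μ₂) * (rewardHittingTime μ₂ ρ T (selectedReward A R (playsAfter k) ω) : ℕ) with hF
  have hsel := isSelection_playsAfter
  have hYm : ∀ k, Measurable (selectedReward A R (playsAfter k)) := fun k =>
    hrun.measurable_selectedReward (hsel k)
  have hfm : Measurable fun x : ℕ → Bool => (rewardHittingTime μ₂ ρ T x : ℝ) :=
    measurable_from_nat.comp (measurable_rewardHittingTime μ₂ ρ T)
  have hFm : ∀ k, Measurable (F k) := fun k => (hfm.comp (hYm k)).const_mul _
  have hGm : ∀ k, AEStronglyMeasurable (G k) P := by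
    intro k
    -- Almost surely the episode time is the first selected time, which gives the measurability of
    -- `G k` up to a null set.
    have hnth : Measurable fun ω => Nat.nth (playsAfter k fun t => A t ω) 0 :=
      measurable_nth (hrun.measurableSet_selection (hsel k)) 0
    have hw : Measurable fun ω => windowRegret μ₁ μ₂ (fun t => A t ω)
        (Nat.nth (playsAfter k fun t => A t ω) 0) T := by
      refine Finset.measurable_sum _ fun i _ => Measurable.const_sub ?_ _
      exact (measurable_of_finite (armMean μ₁ μ₂)).comp
        (measurable_apply_nat (f := fun n ω => A (n + i) ω) (fun n => hrun.measurable_arm (n + i))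
          hnth)
    refine hw.aestronglyMeasurable.congr ?_
    filter_upwards [hinf] with ω hω
    simp only [hG, nth_playsAfter_zero hω k]
  have hδ : 0 < μ₁ - μ₂ := sub_pos.2 hμ
  have hFb : ∀ k ω, 0 ≤ F k ω ∧ F k ω ≤ (μ₁ - μ₂) * T := fun k ω =>
    ⟨by positivity, mul_le_mul_of_nonneg_left
      (by exact_mod_cast clippedHittingTime_le _ _ _ _) hδ.le⟩
  have hGb : ∀ k ω, 0 ≤ G k ω ∧ G k ω ≤ (μ₁ - μ₂) * T := fun k ω =>
    ⟨windowRegret_nonneg hμ _ _ _, windowRegret_le hμ _ _ _⟩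
  have hFi : ∀ k, Integrable (F k) P := fun k =>
    Integrable.of_bound (hFm k).aestronglyMeasurable ((μ₁ - μ₂) * T) (ae_of_all _ fun ω => by
      rw [Real.norm_of_nonneg (hFb k ω).1]; exact (hFb k ω).2)
  have hGi : ∀ k, Integrable (G k) P := fun k =>
    Integrable.of_bound (hGm k) ((μ₁ - μ₂) * T) (ae_of_all _ fun ω => by
      rw [Real.norm_of_nonneg (hGb k ω).1]; exact (hGb k ω).2)
  have hFint : ∀ k, ∫ ω, F k ω ∂P = c := by
    intro k
    have hmap := map_selectedReward_eq hrun (hsel k) (q := q) (by rw [hq]; rfl)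
      (by filter_upwards [hinf] with ω hω using infinite_playsAfter hω k)
    rw [hc, ← hmap, integral_map (hYm k).aemeasurable hfm.aestronglyMeasurable,
      ← integral_const_mul]
  have hlim : Tendsto (fun k => ∫ ω, min (G k ω - F k ω) 0 ∂P) atTop (𝓝 0) := by
    have := tendsto_integral_of_dominated_convergence (μ := P)
      (F := fun k ω => min (G k ω - F k ω) 0) (f := fun _ => 0) (fun _ => (μ₁ - μ₂) * T)
      (fun k => ((hGm k).sub (hFm k).aestronglyMeasurable).inf aestronglyMeasurable_const)
      (integrable_const _)
      (fun k => ae_of_all _ fun ω => by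
        have h1 := hFb k ω
        have h2 := hGb k ω
        rw [Real.norm_eq_abs, abs_of_nonpos (min_le_right _ _), neg_le]
        exact le_min (by linarith) (by linarith))
      (by
        filter_upwards [htyp] with ω hω
        refine tendsto_const_nhds.congr' ?_
        filter_upwards [hω.eventually_le_windowRegret hI hμ₂ hμ hμ₁ T] with k hk
        exact (min_eq_right (sub_nonneg.2 hk)).symm)
    simpa using this
  have hle : ∀ k, c + ∫ ω, min (G k ω - F k ω) 0 ∂P ≤ ∫ ω, G k ω ∂P := by
    intro k
    have hmi : Integrable (fun ω => min (G k ω - F k ω) 0) P :=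
      ((hGi k).sub (hFi k)).inf (integrable_zero _ _ _)
    rw [← hFint k, ← integral_add (hFi k) hmi]
    refine integral_mono ((hFi k).add hmi) (hGi k) fun ω => ?_
    have := min_le_left (G k ω - F k ω) 0
    change F k ω + min (G k ω - F k ω) 0 ≤ G k ω
    linarith
  have hcl : Tendsto (fun k => c + ∫ ω, min (G k ω - F k ω) 0 ∂P) atTop (𝓝 c) := by
    simpa using hlim.const_add c
  rw [← hcl.limsup_eq]
  refine limsup_le_limsup (Eventually.of_forall hle) hcl.isCoboundedUnder_le ?_
  refine isBoundedUnder_of ⟨(μ₁ - μ₂) * T, fun k => ?_⟩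
  calc ∫ ω, G k ω ∂P ≤ ∫ _ω, (μ₁ - μ₂) * T ∂P :=
        integral_mono (hGi k) (integrable_const _) fun ω => (hGb k ω).2
    _ = (μ₁ - μ₂) * T := by simp

end Exploration

theorem mainTheorem5
    (μ₁ μ₂ : ℝ) (hμ₂ : 0 < μ₂) (hμ : μ₂ < μ₁) (hμ₁ : μ₁ < 1)
    (I : ℝ → ℝ → ℝ → ℝ → ℝ≥0∞) (Imax : ℝ≥0∞) (L ρ : ℝ)
    (hI : IsRegularIndex I Imax μ₁ μ₂ L ρ)
    {Ω : Type*} [MeasurableSpace Ω] (P : Measure Ω) [IsProbabilityMeasure P]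
    (A : ℕ → Ω → Fin 2) (R : ℕ → Ω → Bool)
    (hrun : IsBanditRun P μ₁ μ₂ A R) (hindex : FollowsIndex P I A R)
    (T : ℕ)
    {Ω' : Type*} [MeasurableSpace Ω'] (Q : Measure Ω') [IsProbabilityMeasure Q]
    (X : ℕ → Ω' → ℝ) (hX_indep : iIndepFun X Q)
    (hX_law : ∀ i, HasLaw (X i)
      (bernoulliMeasure (1 : ℝ) 0 ⟨μ₂, hμ₂.le, (hμ.trans hμ₁).le⟩) Q) :
    (∀ᵐ ω ∂P, slidingRegret μ₁ μ₂ (fun t => A t ω) T = (μ₁ - μ₂) * T) ∧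
    (∀ᵐ ω ∂P, ∀ k, explorationTime (fun t => A t ω) k ≠ ⊤) ∧
    (μ₁ - μ₂) * ∫ ω, (clippedHittingTime μ₂ ρ (fun i => X i ω) T : ℝ) ∂Q ≤
      regretOfExploration P μ₁ μ₂ A T := by
  have htyp := ae_isTypical hμ₂ hμ hμ₁ hrun hindex
  refine ⟨?_, ?_, ?_⟩
  · have hones := ae_selectedReward hrun (isSelection_playsArm 1)
      (q := ⟨μ₂, hμ₂.le, (hμ.trans hμ₁).le⟩) rfl (ae_frequently_successes (T := T) hμ₂)
    filter_upwards [htyp, hones] with ω hω h1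
    exact slidingRegret_eq hμ (hω.frequently_plays hI hμ₂ hμ hμ₁
      (h1 (hω.infinite_plays hI hμ₂ hμ hμ₁ 1)))
  · filter_upwards [htyp] with ω hω k
    obtain ⟨τ, hτ, -⟩ := explorationTime_spec (hω.infinite_plays hI hμ₂ hμ hμ₁) k
    rw [hτ]
    exact ENat.natCast_ne_top τ
  · rw [integral_clippedHittingTime Q hX_indep hX_law]
    exact le_regretOfExploration hμ₂ hμ hμ₁ hI hrun htyp rfl T
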